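/- Let $T$ be the $\aleph_0$-regular tree, i.e. a countable tree (connected graph without cycles) in which every vertex has infinitely many neighbours, let $\mathrm{Aut}(T)$ be its automorphism group, and for $1\le p\le\infty$ let $\lambda(g)x=x(g^{-1}\,\cdot\,)$ ($g\in \mathrm{Aut}(T)$) denote the shift action on the complex space $\ell_p(T)$. Fix a root $e\in T$, and for $s\ne e$ let $\hat s$ be the penultimate vertex on the geodesic from $e$ to $s$. Let $L\colon \ell_1(T)\to\ell_1(T)$ be the bounded linear operator with $L(\mathbf 1_s)=\mathbf 1_{\hat s}$ for $s\neq e$ and $L(\mathbf 1_e)=0$, and let $L^*\colon\ell_\infty(T)\to\ell_\infty(T)$ be its adjoint. For $g\in\mathrm{Aut}(T)$ the operator $L^*\lambda(g)-\lambda(g)L^*$ restricts to a bounded operator $d(g)$ on $\ell_2(T)$, and $$\lambda_d(g)=\begin{pmatrix}\lambda(g)&d(g)\\0&\lambda(g)\end{pmatrix}$$ defines a representation of $\mathrm{Aut}(T)$ on $\ell_2(T)\oplus\ell_2(T)$. For a Banach space $X$, let $\mathrm{GL}(X)$ be the group of continuous linear automorphisms of $X$; a subgroup $G\le \mathrm{GL}(X)$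 is bounded if $\sup_{A\in G}\|A\|<\infty$; and $\mathtt{sot}$ is the strong operator topology. Suppose that $G\leqslant \mathrm{GL}(\ell_2(T)\oplus\ell_2(T))$ is a bounded subgroup leaving the first copy of $\ell_2(T)$ invariant and containing $\lambda_d[\mathrm{Aut}(T)]$. Then there is a continuous map $\psi\colon\ell_2(T)\to\ell_2(T)$, homogeneous in the sense that $\psi(cx)=c\,\psi(x)$ for all $c\in\mathbb C$ and $x\in\ell_2(T)$, for which $$L^*+\psi\colon\ell_2(T)\to\ell_\infty(T)\quad\text{and}\quad L-\psi\colon\ell_1(T)\to\ell_2(T)$$ commute with $\lambda(g)$ for all $g\in\mathrm{Aut}(T)$, and so that every element of $G$ is of the form $$\begin{pmatrix}u&u\psi-\psi v\\0&v\end{pmatrix}$$ for some $u,v\in \mathrm{GL}(\ell_2(T))$. Moreover, the mappings $$\begin{pmatrix}u&u\psi-\psi v\\0&v\end{pmatrix}\mapsto u\qquad\text{and}\qquad\begin{pmatrix}u&u\psi-\psi v\\0&v\end{pmatrix}\mapsto v$$ are isomorphisms of topological groups between $(G,\mathtt{sot})$ and their respective images in $(\mathrm{GL}(\ell_2(T)),\mathtt{sot})$.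 -/

import Mathlib

open scoped ENNReal

/-- The complex sequence space `ℓ_p(V)` over an index set `V`. -/
noncomputable abbrev Ell (V : Type*) (p : ℝ≥0∞) := lp (fun _ : V => ℂ) p

/-- The inclusion `ℓ_p(V) ⊆ ℓ_q(V)` for `p ≤ q`. -/
noncomputable abbrev ellIncl (V : Type*) {p q : ℝ≥0∞} (h : p ≤ q) : Ell V p →ₗ[ℂ] Ell V q :=
  lp.linearMapOfLE (𝕜 := ℂ) (fun _ : V => ℂ) h

/-- `GL(X)`: the group of all continuous linear automorphisms of `X`. -/
abbrev GLGroup (X : Type*) [NormedAddCommGroup X] [NormedSpace ℂ X] := X ≃L[ℂ] X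

/-- The strong operator topology (the topology of pointwise norm convergence) on `GL(X)`. -/
abbrev sot (X : Type*) [NormedAddCommGroup X] [NormedSpace ℂ X] :
    TopologicalSpace (GLGroup X) :=
  TopologicalSpace.induced (fun A : GLGroup X => (A : X → X)) Pi.topologicalSpace

/-- A bounded subgroup of `GL(X)`, i.e. a uniformly bounded family of operators. -/
def IsBoundedSubgroup {X : Type*} [NormedAddCommGroup X] [NormedSpace ℂ X]
    (G : Subgroup (GLGroup X)) : Prop :=
  ∃ C : ℝ, ∀ A ∈ G, ‖(A : X →L[ℂ] X)‖ ≤ C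

/-- A homomorphism `F : G → GL(Y)` is a `sot`-isomorphism onto its image: it is injective and a
homeomorphism between `G` and its image, both with the strong operator topology. -/
def IsSotIsoOntoImage {X Y : Type*} [NormedAddCommGroup X] [NormedSpace ℂ X]
    [NormedAddCommGroup Y] [NormedSpace ℂ Y]
    (G : Subgroup (GLGroup X)) (F : G →* GLGroup Y) : Prop :=
  @Topology.IsEmbedding G (GLGroup Y)
    (@instTopologicalSpaceSubtype (GLGroup X) (fun A => A ∈ G) (sot X)) (sot Y) F

section Shift

variable {V : Type*} {T : SimpleGraph V}

theorem memlp_shift {p : ℝ≥0∞} (σ : V ≃ V) (x : Ell V p) :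
    Memℓp (fun t : V => x (σ t)) p := by
  have hx := lp.memℓp x
  rcases p.trichotomy with rfl | rfl | hp
  · apply memℓp_zero
    exact (memℓp_zero_iff.1 hx).preimage σ.injective.injOn
  · apply memℓp_infty
    obtain ⟨C, hC⟩ := memℓp_infty_iff.1 hx
    refine ⟨C, ?_⟩
    rintro _ ⟨t, rfl⟩
    exact hC ⟨σ t, rfl⟩
  · exact memℓp_gen ((σ.summable_iff (f := fun t => ‖x t‖ ^ p.toReal)).2 (hx.summable hp))

/-- The isometric shift action `(λ(g) x)(t) = x(g⁻¹ t)` of `Aut(T)` on `ℓ_p(T)`. -/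
noncomputable def lamIsom (p : ℝ≥0∞) [Fact (1 ≤ p)] (g : T ≃g T) :
    Ell V p →ₗᵢ[ℂ] Ell V p where
  toFun x := ⟨fun t => x (g.symm t), memlp_shift g.symm.toEquiv x⟩
  map_add' _ _ := rfl
  map_smul' _ _ := rfl
  norm_map' x := by
    have h1 : (1 : ℝ≥0∞) ≤ p := Fact.out
    rcases p.trichotomy with rfl | rfl | hp
    · simp at h1
    · rw [lp.norm_eq_ciSup, lp.norm_eq_ciSup]
      exact g.symm.toEquiv.iSup_comp (g := fun t => ‖x t‖)
    · rw [lp.norm_eq_tsum_rpow hp, lp.norm_eq_tsum_rpow hp]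
      congr 1
      exact g.symm.toEquiv.tsum_eq (fun t => ‖x t‖ ^ p.toReal)

/-- `λ(g)` as a bounded operator on `ℓ_p(T)`. -/
noncomputable def lam (p : ℝ≥0∞) [Fact (1 ≤ p)] (g : T ≃g T) : Ell V p →L[ℂ] Ell V p :=
  (lamIsom p g).toContinuousLinearMap

theorem lam_apply (p : ℝ≥0∞) [Fact (1 ≤ p)] (g : T ≃g T) (x : Ell V p) (t : V) :
    lam p g x t = x (g.symm t) := rfl

end Shift

namespace TreeDerivation

variable {V : Type*} {T : SimpleGraph V}

/-- The geodesic (the unique path) in the tree `T` from `e` to `s`. -/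
noncomputable def geod (hT : T.IsTree) (e s : V) : T.Walk e s :=
  (hT.existsUnique_path e s).choose

theorem geod_isPath (hT : T.IsTree) (e s : V) : (geod hT e s).IsPath :=
  (hT.existsUnique_path e s).choose_spec.1

theorem eq_geod (hT : T.IsTree) {e s : V} (p : T.Walk e s) (hp : p.IsPath) : p = geod hT e s :=
  (hT.existsUnique_path e s).choose_spec.2 p hp

/-- `ŝ`: the penultimate vertex of the geodesic from `e` to `s`, with `ê = e`. -/
noncomputable def hat (hT : T.IsTree) (e s : V) : V := (geod hT e s).penultimate

theorem hat_root (hT : T.IsTree) (e : V) : hat hT e e = e := by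
  have : (SimpleGraph.Walk.nil : T.Walk e e) = geod hT e e := eq_geod hT _ (by simp)
  rw [hat, ← this]
  rfl

theorem adj_hat (hT : T.IsTree) {e s : V} (h : s ≠ e) : T.Adj (hat hT e s) s :=
  SimpleGraph.Walk.adj_penultimate (SimpleGraph.Walk.not_nil_of_ne h.symm)

theorem hat_map (hT : T.IsTree) (g : T ≃g T) (e s : V) :
    hat hT (g e) (g s) = g (hat hT e s) := by
  have h : ((geod hT e s).map g.toHom).IsPath :=
    (geod_isPath hT e s).map g.injective
  have h2 := eq_geod hT _ h
  unfold hat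
  change (geod hT (g.toHom e) (g.toHom s)).penultimate = _
  rw [← h2]
  simp [SimpleGraph.Walk.penultimate, SimpleGraph.Walk.getVert_map]

theorem hat_eq_of_adj (hT : T.IsTree) {a b t : V} (h : T.Adj a b) (ha : t ≠ a) (hb : t ≠ b) :
    hat hT a t = hat hT b t := by
  classical
  by_cases hm : b ∈ (geod hT a t).support
  · have hq := eq_geod hT _ ((geod_isPath hT a t).dropUntil hm)
    have hspec := (geod hT a t).take_spec hm
    unfold hat
    rw [← hq]
    conv_lhs => rw [← hspec]
    generalize (geod hT a t).takeUntil b hm = p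
    have hn : ¬ ((geod hT a t).dropUntil b hm).Nil := SimpleGraph.Walk.not_nil_of_ne hb.symm
    revert hn
    generalize (geod hT a t).dropUntil b hm = q
    intro hn
    clear hspec hq hm h ha
    induction p with
    | nil => rfl
    | cons h p ih =>
      rw [SimpleGraph.Walk.cons_append, SimpleGraph.Walk.penultimate_cons_of_not_nil, ih hb q hn]
      intro hnil
      apply hn
      rw [← SimpleGraph.Walk.length_eq_zero_iff] at hnil ⊢
      rw [SimpleGraph.Walk.length_append] at hnil
      omega
  · have hq := eq_geod hT (SimpleGraph.Walk.cons h.symm (geod hT a t))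
      ((SimpleGraph.Walk.cons_isPath_iff _ _).2 ⟨geod_isPath hT a t, hm⟩)
    unfold hat
    rw [← hq, SimpleGraph.Walk.penultimate_cons_of_not_nil]
    exact SimpleGraph.Walk.not_nil_of_ne ha.symm

theorem hat_eq_of_walk (hT : T.IsTree) {a b t : V} (w : T.Walk a b) (ht : t ∉ w.support) :
    hat hT a t = hat hT b t := by
  induction w with
  | nil => rfl
  | cons h p ih =>
    simp only [SimpleGraph.Walk.support_cons, List.mem_cons, not_or] at ht
    rw [← ih ht.2]
    exact hat_eq_of_adj hT h ht.1 (fun hc => ht.2 (hc ▸ p.start_mem_support))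

open Classical in
/-- The image under `L` of the Dirac function at `s`: it is `1_ŝ` if `s ≠ e`, and `0` if `s = e`. -/
noncomputable def LBasis (hT : T.IsTree) (e s : V) : Ell V 1 :=
  if s = e then 0 else lp.single 1 (hat hT e s) (1 : ℂ)

theorem norm_LBasis_le (hT : T.IsTree) (e s : V) : ‖LBasis hT e s‖ ≤ 1 := by
  classical
  unfold LBasis
  split_ifs
  · simp
  · rw [lp.norm_single (by simp)]
    simp

theorem summable_L (hT : T.IsTree) (e : V) (x : Ell V 1) :
    Summable fun s => ‖x s • LBasis hT e s‖ := by
  have h : Summable fun s => ‖x s‖ := by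
    have := (lp.memℓp x).summable (by simp)
    simpa using this
  refine Summable.of_nonneg_of_le (fun _ => norm_nonneg _) (fun s => ?_) h
  rw [norm_smul]
  exact mul_le_of_le_one_right (norm_nonneg _) (norm_LBasis_le hT e s)

/-- The bounded operator `L : ℓ_1(T) → ℓ_1(T)` with `L 1_s = 1_ŝ` for `s ≠ e` and `L 1_e = 0`. -/
noncomputable def L (hT : T.IsTree) (e : V) : Ell V 1 →L[ℂ] Ell V 1 :=
  LinearMap.mkContinuous
    { toFun := fun x => ∑' s, x s • LBasis hT e s
      map_add' := fun x y => by
        rw [← (summable_L hT e x).of_norm.tsum_add (summable_L hT e y).of_norm]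
        simp [add_smul]
      map_smul' := fun c x => by
        rw [RingHom.id_apply, ← (summable_L hT e x).of_norm.tsum_const_smul c]
        simp [mul_smul] }
    1 (fun x => by
      have h : Summable fun s => ‖x s‖ := by
        have := (lp.memℓp x).summable (by simp)
        simpa using this
      have hn : ‖x‖ = ∑' s, ‖x s‖ := by
        rw [lp.norm_eq_tsum_rpow (by simp)]
        simp
      rw [one_mul, hn]
      refine (norm_tsum_le_tsum_norm (summable_L hT e x)).trans ?_
      refine (summable_L hT e x).tsum_le_tsum (fun s => ?_) h
      rw [norm_smul]
      exact mul_le_of_le_one_right (norm_nonneg _) (norm_LBasis_le hT e s))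

open Classical in
theorem L_single (hT : T.IsTree) (e s : V) :
    L hT e (lp.single 1 s (1 : ℂ)) = if s = e then 0 else lp.single 1 (hat hT e s) (1 : ℂ) := by
  change (∑' r, (lp.single 1 s (1 : ℂ) : Ell V 1) r • LBasis hT e r) = LBasis hT e s
  rw [tsum_eq_single s]
  · simp
  · intro r hr
    rw [lp.single_apply_ne _ _ _ hr, zero_smul]

open Classical in
/-- The adjoint `L* : ℓ_∞(T) → ℓ_∞(T)` of `L`: `(L* y)(t) = y(t̂)` for `t ≠ e` and `(L* y)(e) = 0`;
see `L_adjoint`. -/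
noncomputable def Lstar (hT : T.IsTree) (e : V) : Ell V ∞ →L[ℂ] Ell V ∞ :=
  LinearMap.mkContinuous
    { toFun := fun y => ⟨fun t => if t = e then 0 else y (hat hT e t), by
        apply memℓp_infty
        refine ⟨‖y‖, ?_⟩
        rintro _ ⟨t, rfl⟩
        dsimp only
        split_ifs
        · simp
        · exact lp.norm_apply_le_norm (by simp) y _⟩
      map_add' := fun x y => by
        ext t
        change (if t = e then 0 else x (hat hT e t) + y (hat hT e t)) =
          (if t = e then 0 else x (hat hT e t)) + (if t = e then 0 else y (hat hT e t))
        split_ifs <;> simp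
      map_smul' := fun c x => by
        ext t
        by_cases h : t = e <;> simp [h] }
    1 (fun y => by
      rw [one_mul]
      refine lp.norm_le_of_forall_le (norm_nonneg _) (fun t => ?_)
      simp only [LinearMap.coe_mk, AddHom.coe_mk]
      split_ifs
      · simp
      · exact lp.norm_apply_le_norm (by simp) y _)

open Classical in
theorem Lstar_apply (hT : T.IsTree) (e : V) (y : Ell V ∞) (t : V) :
    Lstar hT e y t = if t = e then 0 else y (hat hT e t) := rfl

/-- `L*` is the adjoint of `L` for the pairing of `ℓ_1(T)` with `ℓ_∞(T)`. -/
theorem L_adjoint (hT : T.IsTree) (e : V) (x : Ell V 1) (y : Ell V ∞) :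
    ∑' t, L hT e x t * y t = ∑' t, x t * Lstar hT e y t := by
  classical
  have hs (z : Ell V 1) : Summable fun t => ‖z t‖ := by
    have := (lp.memℓp z).summable (by simp)
    simpa using this
  have hy (t : V) : ‖y t‖ ≤ ‖y‖ := lp.norm_apply_le_norm (by simp) y t
  have hsy (z : Ell V 1) : Summable fun t => ‖z t * y t‖ := by
    refine Summable.of_nonneg_of_le (fun _ => norm_nonneg _) (fun t => ?_)
      ((hs z).mul_right ‖y‖)
    rw [norm_mul]
    exact mul_le_mul_of_nonneg_left (hy t) (norm_nonneg _)
  let P : Ell V 1 →L[ℂ] ℂ := LinearMap.mkContinuous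
    { toFun := fun z => ∑' t, z t * y t
      map_add' := fun z w => by
        rw [← (hsy z).of_norm.tsum_add (hsy w).of_norm]
        simp [add_mul]
      map_smul' := fun c z => by
        rw [RingHom.id_apply, smul_eq_mul, ← tsum_mul_left]
        simp [mul_assoc] }
    ‖y‖ (fun z => by
      have hn : ‖z‖ = ∑' s, ‖z s‖ := by
        rw [lp.norm_eq_tsum_rpow (by simp)]
        simp
      rw [hn, mul_comm, ← tsum_mul_right]
      refine (norm_tsum_le_tsum_norm (hsy z)).trans ?_
      refine (hsy z).tsum_le_tsum (fun t => ?_) ((hs z).mul_right ‖y‖)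
      rw [norm_mul]
      exact mul_le_mul_of_nonneg_left (hy t) (norm_nonneg _))
  have hP (t : V) : P (LBasis hT e t) = Lstar hT e y t := by
    rw [Lstar_apply]
    unfold LBasis
    split_ifs with h
    · simp
    · change (∑' r, (lp.single 1 (hat hT e t) (1 : ℂ) : Ell V 1) r * y r) = _
      rw [tsum_eq_single (hat hT e t)]
      · simp
      · intro r hr
        rw [lp.single_apply_ne _ _ _ hr, zero_mul]
  change P (∑' s, x s • LBasis hT e s) = _
  rw [P.map_tsum (summable_L hT e x).of_norm]
  simp [hP]

/-- The function `L* λ(g) x - λ(g) L* x`, an element of `ℓ_∞(T)`, for `x ∈ ℓ_2(T)`. -/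
noncomputable def dInfty (hT : T.IsTree) (e : V) (g : T ≃g T) : Ell V 2 →ₗ[ℂ] Ell V ∞ :=
  ((Lstar hT e).comp (lam ∞ g) - (lam ∞ g).comp (Lstar hT e)).toLinearMap.comp
    (ellIncl V le_top)

open Classical in
theorem dInfty_apply (hT : T.IsTree) (e : V) (g : T ≃g T) (x : Ell V 2) (t : V) :
    dInfty hT e g x t = (if t = e then 0 else x (g.symm (hat hT e t))) -
      (if g.symm t = e then 0 else x (hat hT e (g.symm t))) := rfl

theorem dInfty_apply_eq_zero (hT : T.IsTree) (e : V) (g : T ≃g T) (x : Ell V 2) {t : V}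
    (ht : t ∉ (geod hT e (g e)).support) : dInfty hT e g x t = 0 := by
  have h1 : t ≠ e := fun h => ht (h ▸ SimpleGraph.Walk.start_mem_support _)
  have h2 : g.symm t ≠ e := fun h =>
    ht ((g.symm_apply_eq.1 h) ▸ SimpleGraph.Walk.end_mem_support _)
  have h3 : hat hT e t = g (hat hT e (g.symm t)) := by
    rw [hat_eq_of_walk hT _ ht, ← hat_map hT g e (g.symm t), g.apply_symm_apply]
  rw [dInfty_apply, if_neg h1, if_neg h2, h3, g.symm_apply_apply, sub_self]

theorem memlp_d (hT : T.IsTree) (e : V) (g : T ≃g T) (x : Ell V 2) :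
    Memℓp (dInfty hT e g x : V → ℂ) 2 := by
  refine (memℓp_zero ?_).of_exponent_ge (by simp)
  refine ((geod hT e (g e)).support.finite_toSet).subset (fun t ht => ?_)
  by_contra hc
  exact ht (dInfty_apply_eq_zero hT e g x hc)

/-- The linear map `L* λ(g) - λ(g) L*` restricted to `ℓ_2(T)`. -/
noncomputable def dLin (hT : T.IsTree) (e : V) (g : T ≃g T) : Ell V 2 →ₗ[ℂ] Ell V 2 where
  toFun x := ⟨dInfty hT e g x, memlp_d hT e g x⟩
  map_add' x y := by
    apply lp.ext
    change ⇑(dInfty hT e g (x + y)) = ⇑(dInfty hT e g x) + ⇑(dInfty hT e g y)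
    rw [map_add, lp.coeFn_add]
  map_smul' c x := by
    apply lp.ext
    change ⇑(dInfty hT e g (c • x)) = c • ⇑(dInfty hT e g x)
    rw [map_smul, lp.coeFn_smul]

theorem continuous_dLin (hT : T.IsTree) (e : V) (g : T ≃g T) : Continuous (dLin hT e g) := by
  classical
  have key : (fun x => dLin hT e g x) = fun x => ∑ t ∈ (geod hT e (g e)).support.toFinset,
      lp.singleContinuousLinearMap ℂ (fun _ : V => ℂ) 2 t (dInfty hT e g x t) := by
    funext x
    apply lp.ext
    funext s
    rw [lp.coeFn_sum, Finset.sum_apply]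
    change dInfty hT e g x s = _
    by_cases hs : s ∈ (geod hT e (g e)).support
    · rw [Finset.sum_eq_single s]
      · simp
      · intro t _ hts
        simp [hts.symm]
      · intro h
        exact absurd (List.mem_toFinset.2 hs) h
    · rw [dInfty_apply_eq_zero hT e g x hs, Finset.sum_eq_zero]
      intro t ht
      have hts : s ≠ t := fun h => hs (h ▸ List.mem_toFinset.1 ht)
      simp [hts]
  change Continuous fun x => dLin hT e g x
  rw [key]
  refine continuous_finsetSum _ (fun t _ => (ContinuousLinearMap.continuous _).comp ?_)
  have hev (s : V) : Continuous fun x : Ell V 2 => x s :=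
    (lp.evalCLM ℂ (fun _ : V => ℂ) 2 s).continuous
  simp only [dInfty_apply]
  split_ifs
  · exact continuous_const
  · exact continuous_const.sub (hev _)
  · exact (hev _).sub continuous_const
  · exact (hev _).sub (hev _)

/-- The derivation `d(g) = L* λ(g) - λ(g) L*`, as a bounded operator on `ℓ_2(T)`. -/
noncomputable def d (hT : T.IsTree) (e : V) (g : T ≃g T) : Ell V 2 →L[ℂ] Ell V 2 :=
  ⟨dLin hT e g, continuous_dLin hT e g⟩

theorem ellIncl_d (hT : T.IsTree) (e : V) (g : T ≃g T) (x : Ell V 2) :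
    ellIncl V le_top (d hT e g x) =
      Lstar hT e (lam ∞ g (ellIncl V le_top x)) - lam ∞ g (Lstar hT e (ellIncl V le_top x)) := rfl

open Classical in
theorem d_apply (hT : T.IsTree) (e : V) (g : T ≃g T) (x : Ell V 2) (t : V) :
    d hT e g x t = (if t = e then 0 else x (g.symm (hat hT e t))) -
      (if g.symm t = e then 0 else x (hat hT e (g.symm t))) := rfl

theorem d_mul (hT : T.IsTree) (e : V) (g f : T ≃g T) :
    d hT e (g * f) = (lam 2 g).comp (d hT e f) + (d hT e g).comp (lam 2 f) := by
  classical
  ext x t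
  change d hT e (g * f) x t = d hT e f x (g.symm t) + d hT e g (lam 2 f x) t
  simp only [d_apply, lam_apply]
  have h (s : V) : (g * f).symm s = f.symm (g.symm s) := rfl
  simp only [h]
  ring

/-- The representation `λ_d` of `Aut(T)` by the operators with block matrices
`(λ(g), d(g); 0, λ(g))` on `ℓ_2(T) ⊕ ℓ_2(T)`. -/
noncomputable def lamDHom (hT : T.IsTree) (e : V) :
    (T ≃g T) →* ((Ell V 2 × Ell V 2) →L[ℂ] (Ell V 2 × Ell V 2)) where
  toFun g := ((lam 2 g).coprod (d hT e g)).prod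
    ((lam 2 g).comp (ContinuousLinearMap.snd ℂ (Ell V 2) (Ell V 2)))
  map_one' := by
    have h1 : d hT e (1 : T ≃g T) = 0 := by
      ext x t
      change d hT e (1 : T ≃g T) x t = 0
      rw [d_apply]
      exact sub_self _
    rw [h1]
    have h (z : Ell V 2) : lam 2 (1 : T ≃g T) z = z := rfl
    apply ContinuousLinearMap.ext
    rintro ⟨x, y⟩
    simp [h]
  map_mul' g f := by
    rw [d_mul]
    apply ContinuousLinearMap.ext
    rintro ⟨x, y⟩
    have h (z : Ell V 2) : lam 2 (g * f) z = lam 2 g (lam 2 f z) := rfl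
    refine Prod.ext ?_ ?_
    · simp [h, add_assoc]
    · simp [h]

/-- `λ_d` as a homomorphism from `Aut(T)` to `GL(ℓ_2(T) ⊕ ℓ_2(T))`. -/
noncomputable def lamD (hT : T.IsTree) (e : V) :
    (T ≃g T) →* GLGroup (Ell V 2 × Ell V 2) :=
  (ContinuousLinearEquiv.unitsEquiv ℂ (Ell V 2 × Ell V 2)).toMonoidHom.comp
    (lamDHom hT e).toHomUnits

theorem lamD_apply (hT : T.IsTree) (e : V) (g : T ≃g T) (x y : Ell V 2) :
    lamD hT e g (x, y) = (lam 2 g x + d hT e g y, lam 2 g y) := rfl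

end TreeDerivation

/-! Boundedness of `G` gives two things: an invariant uniformly convex norm, which produces `ψ`, and
a projection onto continuous vectors, which produces the topological statement.

For a bounded representation on a Hilbert space, the supremum of the norm over orbits is an
equivalent invariant norm that still satisfies a quantitative parallelogram inequality. So every
closed nonempty convex set has a unique point of least norm. Apply this to the cosets of the first
summand: the coset over `y` has a unique nearest point `(φ y, y)` to the origin. Since `G` permutes
the cosets and preserves the norm, it preserves the graph of `φ` (`exists_invariant_graph`). Writing
`(x, y) = (x - φ y, 0) + (φ y, y)` gives the matrix form with `ψ = -φ`. For `λ_d(g)` it reads `d(g)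
= φ λ(g) - λ(g) φ`, which is the commutation of `L* + ψ` with `λ(g)`. The statement for `L - ψ`
follows because `L + L*` is the adjacency operator, which commutes with automorphisms
(`ellIncl_L_lam`).

For the topology, pull the strong operator topology back to `G` along a diagonal block. By
boundedness this is a group topology, and the vectors with continuous orbit maps are the range of a
bounded idempotent commuting with `G` (`exists_continuousVector_projection`). Such an idempotent is
`0` or `1`, because `λ` is irreducible and `d` is not inner (`eq_zero_or_one_of_commute_lamD`). It
is not `0`, since some matrix coefficient depends only on the block. Hence all orbit maps are
continuous, and the block determines the topology of `G` and its elements. -/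

section BoundedRepresentation

/-! ### Invariant uniformly convex norms and asymptotic minimisers. -/

open Filter Topology

variable {Γ H : Type*} [Group Γ] [NormedAddCommGroup H] [InnerProductSpace ℂ H]

/-- The norm `z ↦ sup_g ‖π(g) z‖`, invariant under the representation `π`. -/
noncomputable def orbitNorm (π : Γ →* (H →L[ℂ] H)) (z : H) : ℝ := ⨆ g, ‖π g z‖

namespace orbitNorm

variable {π : Γ →* (H →L[ℂ] H)} {C : ℝ}

theorem bddAbove (hC : ∀ g, ‖π g‖ ≤ C) (z : H) : BddAbove (Set.range fun g => ‖π g z‖) := by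
  refine ⟨C * ‖z‖, ?_⟩
  rintro _ ⟨g, rfl⟩
  exact (π g).le_of_opNorm_le (hC g) z

theorem apply_le (hC : ∀ g, ‖π g‖ ≤ C) (g : Γ) (z : H) : ‖π g z‖ ≤ orbitNorm π z :=
  le_ciSup (bddAbove hC z) g

theorem nonneg (z : H) : 0 ≤ orbitNorm π z := Real.iSup_nonneg fun _ => norm_nonneg _

theorem le_mul (hC : ∀ g, ‖π g‖ ≤ C) (z : H) : orbitNorm π z ≤ C * ‖z‖ :=
  ciSup_le fun g => (π g).le_of_opNorm_le (hC g) z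

theorem add_le (hC : ∀ g, ‖π g‖ ≤ C) (x y : H) :
    orbitNorm π (x + y) ≤ orbitNorm π x + orbitNorm π y := by
  refine ciSup_le fun g => ?_
  rw [map_add]
  exact (norm_add_le _ _).trans (add_le_add (apply_le hC g x) (apply_le hC g y))

theorem smul (c : ℂ) (x : H) : orbitNorm π (c • x) = ‖c‖ * orbitNorm π x := by
  simp only [orbitNorm, map_smul, norm_smul]
  exact (Real.mul_iSup_of_nonneg (norm_nonneg c) _).symm

theorem apply (h : Γ) (x : H) : orbitNorm π (π h x) = orbitNorm π x := by
  have : ∀ g, ‖π g (π h x)‖ = ‖π (g * h) x‖ := fun g => by simp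
  simp only [orbitNorm, this]
  exact (Equiv.mulRight h).iSup_comp (g := fun g => ‖π g x‖)

theorem lipschitz (hC : ∀ g, ‖π g‖ ≤ C) (x y : H) :
    |orbitNorm π x - orbitNorm π y| ≤ C * ‖x - y‖ := by
  have h1 := add_le hC (x - y) y
  have h2 := add_le hC (y - x) x
  rw [sub_add_cancel] at h1 h2
  have h3 := le_mul hC (x - y)
  have h4 := le_mul hC (y - x)
  rw [norm_sub_rev] at h4
  exact abs_sub_le_iff.2 ⟨by linarith, by linarith⟩

theorem continuous (hC : ∀ g, ‖π g‖ ≤ C) : Continuous (orbitNorm π) := by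
  refine continuous_iff_continuousAt.2 fun x => ?_
  refine tendsto_iff_norm_sub_tendsto_zero.2 ?_
  refine squeeze_zero (fun _ => norm_nonneg _) (fun y => lipschitz hC y x) ?_
  have : Continuous fun y : H => C * ‖y - x‖ := by fun_prop
  simpa using this.tendsto x

/-- Uniform convexity survives the supremum: the parallelogram law holds for each `π g`, and its
term `‖π g (x - y)‖` is at least `‖x - y‖ / C` for all `g` at once, because `π g⁻¹` has norm at most
`C`. -/
theorem parallelogram (hC1 : 1 ≤ C) (hC : ∀ g, ‖π g‖ ≤ C) (x y : H) :
    ‖x - y‖ ^ 2 ≤ C ^ 2 *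
      (2 * orbitNorm π x ^ 2 + 2 * orbitNorm π y ^ 2 - orbitNorm π (x + y) ^ 2) := by
  have hC0 : 0 < C ^ 2 := by positivity
  have key (g : Γ) : ‖π g (x + y)‖ ^ 2 ≤
      2 * orbitNorm π x ^ 2 + 2 * orbitNorm π y ^ 2 - ‖x - y‖ ^ 2 / C ^ 2 := by
    have h1 := parallelogram_law_with_norm ℂ (π g x) (π g y)
    have h2 : ‖x - y‖ ≤ C * ‖π g (x - y)‖ := by
      have := (π g⁻¹).le_of_opNorm_le (hC g⁻¹) (π g (x - y))
      rwa [← mul_apply_eq_comp, ← map_mul, inv_mul_cancel, map_one] at this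
    have h3 : ‖x - y‖ ^ 2 / C ^ 2 ≤ ‖π g (x - y)‖ ^ 2 := by
      rw [div_le_iff₀ hC0, ← mul_pow, mul_comm]
      exact pow_le_pow_left₀ (norm_nonneg _) h2 2
    have h4 := pow_le_pow_left₀ (norm_nonneg _) (apply_le hC g x) 2
    have h5 := pow_le_pow_left₀ (norm_nonneg _) (apply_le hC g y) 2
    rw [map_sub] at h3
    rw [map_add]
    nlinarith
  -- Nonnegativity of the bound, needed to pass to square roots, take the supremum over `g`, and
  -- square again.
  have hD := (sq_nonneg _).trans (key 1)
  have h6 : orbitNorm π (x + y) ≤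
      √(2 * orbitNorm π x ^ 2 + 2 * orbitNorm π y ^ 2 - ‖x - y‖ ^ 2 / C ^ 2) :=
    ciSup_le fun g => Real.le_sqrt_of_sq_le (key g)
  have h7 := pow_le_pow_left₀ (nonneg _) h6 2
  rw [Real.sq_sqrt hD] at h7
  have h8 : ‖x - y‖ ^ 2 = C ^ 2 * (‖x - y‖ ^ 2 / C ^ 2) := by field_simp
  rw [h8]
  exact mul_le_mul_of_nonneg_left (by linarith) hC0.le

/-- The midpoint stays in `K`, so `orbitNorm π (x + y) ^ 2 ≥ 4 * a`, and the parallelogram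
inequality leaves `4 * (b - a)`. -/
theorem dist_le_of_almost_minimal (hC1 : 1 ≤ C) (hC : ∀ g, ‖π g‖ ≤ C) {K : Set H}
    (hK : Convex ℝ K) {a b : ℝ} (ha : ∀ w ∈ K, a ≤ orbitNorm π w ^ 2) {x y : H} (hx : x ∈ K)
    (hy : y ∈ K) (hxb : orbitNorm π x ^ 2 ≤ b) (hyb : orbitNorm π y ^ 2 ≤ b) :
    ‖x - y‖ ≤ C * √(4 * (b - a)) := by
  have h1 : (2⁻¹ : ℂ) • (x + y) ∈ K := by
    have := hK hx hy (a := 2⁻¹) (b := 2⁻¹) (by norm_num) (by norm_num) (by norm_num)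
    rw [← smul_add] at this
    convert this using 1
    rw [← Complex.coe_smul]
    norm_num
  have h2 := ha _ h1
  rw [smul, mul_pow] at h2
  have h3 : ‖(2⁻¹ : ℂ)‖ = 2⁻¹ := by simp
  rw [h3] at h2
  have h4 := parallelogram hC1 hC x y
  have h5 : ‖x - y‖ ^ 2 ≤ C ^ 2 * (4 * (b - a)) :=
    h4.trans (mul_le_mul_of_nonneg_left (by linarith) (by positivity))
  have h6 := Real.abs_le_sqrt h5
  rwa [abs_of_nonneg (norm_nonneg _), Real.sqrt_mul (by positivity),
    Real.sqrt_sq (by linarith)] at h6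

/-- A directed family of convex sets contains an asymptotically norm-minimising limit point. -/
theorem exists_limit [CompleteSpace H] (hC1 : 1 ≤ C) (hC : ∀ g, ‖π g‖ ≤ C) {ι : Type*}
    [Nonempty ι] (K : ι → Set H) (hK : ∀ i, Convex ℝ (K i)) (hdir : Directed (· ⊇ ·) K) (R : ℝ)
    (hR : ∀ i, ∃ w ∈ K i, orbitNorm π w ^ 2 ≤ R) :
    ∃ (ρ : ℝ) (p : H), (∀ ε > 0, ∃ i, ∀ w ∈ K i, ρ - ε ≤ orbitNorm π w ^ 2) ∧
      ∀ i, ∀ ε > 0, ∃ w ∈ K i, ‖w - p‖ < ε ∧ orbitNorm π w ^ 2 ≤ ρ + ε := by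
  let m : ι → ℝ := fun i => sInf ((fun w => orbitNorm π w ^ 2) '' K i)
  have hbelow (i : ι) : BddBelow ((fun w => orbitNorm π w ^ 2) '' K i) := by
    refine ⟨0, ?_⟩
    rintro _ ⟨w, _, rfl⟩
    exact sq_nonneg _
  have hm (i : ι) : ∀ w ∈ K i, m i ≤ orbitNorm π w ^ 2 :=
    fun w hw => csInf_le (hbelow i) ⟨w, hw, rfl⟩
  have hmR : BddAbove (Set.range m) := by
    refine ⟨R, ?_⟩
    rintro _ ⟨i, rfl⟩
    obtain ⟨w, hw, h⟩ := hR i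
    exact (hm i w hw).trans h
  -- The infima `m i` grow as the sets shrink and are bounded by `R`; their supremum is the
  -- asymptotic minimum.
  let ρ : ℝ := ⨆ i, m i
  have hlow : ∀ ε > 0, ∃ i, ∀ w ∈ K i, ρ - ε ≤ orbitNorm π w ^ 2 := by
    intro ε hε
    obtain ⟨i, hi⟩ := exists_lt_of_lt_ciSup (show ρ - ε < ⨆ i, m i from sub_lt_self _ hε)
    exact ⟨i, fun w hw => hi.le.trans (hm i w hw)⟩
  have hup : ∀ i, ∀ ε > 0, ∃ w ∈ K i, orbitNorm π w ^ 2 ≤ ρ + ε := by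
    intro i ε hε
    have hne : ((fun w => orbitNorm π w ^ 2) '' K i).Nonempty := by
      obtain ⟨w, hw, _⟩ := hR i
      exact ⟨_, w, hw, rfl⟩
    have h : m i < ρ + ε := (le_ciSup hmR i).trans_lt (lt_add_of_pos_right _ hε)
    obtain ⟨_, ⟨w, hw, rfl⟩, h2⟩ := exists_lt_of_csInf_lt hne h
    exact ⟨w, hw, h2.le⟩
  -- The factor 2 comes from comparing points of two different sets through a third almost minimal
  -- point in a common subset.
  let δ : ℝ → ℝ := fun ε => 2 * (C * √(4 * (ρ + ε - (ρ - ε))))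
  have hclose : ∀ ε > 0, ∀ i i', (∀ w ∈ K i, ρ - ε ≤ orbitNorm π w ^ 2) →
      (∀ w ∈ K i', ρ - ε ≤ orbitNorm π w ^ 2) → ∀ w ∈ K i, ∀ w' ∈ K i',
      orbitNorm π w ^ 2 ≤ ρ + ε → orbitNorm π w' ^ 2 ≤ ρ + ε → ‖w - w'‖ ≤ δ ε := by
    intro ε hε i i' hi hi' w hw w' hw' h h'
    obtain ⟨k, hk, hk'⟩ := hdir i i'
    obtain ⟨z, hz, hzε⟩ := hup k ε hε
    have h1 := dist_le_of_almost_minimal hC1 hC (hK i) hi hw (hk hz) h hzε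
    have h2 := dist_le_of_almost_minimal hC1 hC (hK i') hi' (hk' hz) hw' hzε h'
    have h3 := norm_sub_le_norm_sub_add_norm_sub w z w'
    simp only [δ]
    linarith
  let ε : ℕ → ℝ := fun n => 1 / ((n : ℝ) + 1)
  have hε (n : ℕ) : 0 < ε n := by positivity
  have hε0 : Tendsto ε atTop (𝓝 0) := tendsto_one_div_add_atTop_nhds_zero_nat
  have hδ0 : Tendsto (fun n => δ (ε n)) atTop (𝓝 0) := by
    have : Continuous δ := by fun_prop
    have h := (this.tendsto 0).comp hε0
    simpa only [δ, Function.comp_def, add_zero, sub_zero, sub_self, mul_zero, Real.sqrt_zero] using h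
  have hεanti : Antitone ε := fun a b hab => Nat.one_div_le_one_div hab
  choose i hi using fun n => hlow (ε n) (hε n)
  choose w hw hwε using fun n => hup (i n) (ε n) (hε n)
  have hcauchy : CauchySeq w := by
    refine cauchySeq_of_le_tendsto_0 (fun n => δ (ε n)) (fun a b n ha hb => ?_) hδ0
    rw [dist_eq_norm]
    refine hclose (ε n) (hε n) (i a) (i b) (fun z hz => ?_) (fun z hz => ?_) _ (hw a) _ (hw b)
      ?_ ?_
    · linarith [hi a z hz, hεanti ha]
    · linarith [hi b z hz, hεanti hb]
    · linarith [hwε a, hεanti ha]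
    · linarith [hwε b, hεanti hb]
  obtain ⟨p, hp⟩ := cauchySeq_tendsto_of_complete hcauchy
  refine ⟨ρ, p, hlow, fun j η hη => ?_⟩
  have hp' : Tendsto (fun n => ‖w n - p‖) atTop (𝓝 0) := tendsto_iff_norm_sub_tendsto_zero.1 hp
  obtain ⟨n, h1, h2, h3⟩ := ((hp'.eventually (gt_mem_nhds (half_pos hη))).and
    ((hδ0.eventually (gt_mem_nhds (half_pos hη))).and
      (hε0.eventually (gt_mem_nhds hη)))).exists
  obtain ⟨k, hkj, hkn⟩ := hdir j (i n)
  obtain ⟨z, hz, hzε⟩ := hup k (ε n) (hε n)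
  refine ⟨z, hkj hz, ?_, by linarith⟩
  have h4 := hclose (ε n) (hε n) (i n) (i n) (hi n) (hi n) z (hkn hz) (w n) (hw n) hzε (hwε n)
  have h5 := norm_sub_le_norm_sub_add_norm_sub z (w n) p
  linarith

/-- This is `exists_limit` for a constant family: closedness puts the limit in `K` and continuity of
the norm makes it a minimiser. -/
theorem exists_minimal [CompleteSpace H] (hC1 : 1 ≤ C) (hC : ∀ g, ‖π g‖ ≤ C) {K : Set H}
    (hK : Convex ℝ K) (hcl : IsClosed K) (hne : K.Nonempty) :
    ∃ p ∈ K, ∀ w ∈ K, orbitNorm π p ≤ orbitNorm π w := by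
  obtain ⟨w₀, hw₀⟩ := hne
  obtain ⟨ρ, p, h1, h2⟩ := exists_limit hC1 hC (fun _ : Unit => K) (fun _ => hK)
    (fun _ _ => ⟨(), subset_rfl, subset_rfl⟩) _ (fun _ => ⟨w₀, hw₀, le_rfl⟩)
  have hp : p ∈ K := by
    rw [← hcl.closure_eq, Metric.mem_closure_iff]
    intro ε hε
    obtain ⟨w, hw, h, _⟩ := h2 () ε hε
    exact ⟨w, hw, by rwa [dist_comm, dist_eq_norm]⟩
  have h3 : ∀ w ∈ K, ρ ≤ orbitNorm π w ^ 2 := fun w hw =>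
    le_of_forall_pos_le_add fun ε hε => by
      obtain ⟨_, h⟩ := h1 ε hε
      linarith [h w hw]
  choose w hw hwp hwρ using fun n : ℕ => h2 () (1 / ((n : ℝ) + 1)) (by positivity)
  have hlim : Tendsto w atTop (𝓝 p) := tendsto_iff_norm_sub_tendsto_zero.2
    (squeeze_zero (fun _ => norm_nonneg _) (fun n => (hwp n).le)
      tendsto_one_div_add_atTop_nhds_zero_nat)
  have h4 : orbitNorm π p ^ 2 ≤ ρ := by
    refine le_of_tendsto_of_tendsto ((((continuous hC).pow 2).tendsto p).comp hlim)
      (g := fun n : ℕ => ρ + 1 / ((n : ℝ) + 1)) ?_ (Eventually.of_forall hwρ)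
    simpa using (tendsto_const_nhds (x := ρ)).add
      (tendsto_one_div_add_atTop_nhds_zero_nat (𝕜 := ℝ))
  refine ⟨p, hp, fun w hw => ?_⟩
  exact (sq_le_sq₀ (nonneg _) (nonneg _)).1 (h4.trans (h3 w hw))

theorem minimal_unique (hC1 : 1 ≤ C) (hC : ∀ g, ‖π g‖ ≤ C) {K : Set H}
    (hK : Convex ℝ K) {p q : H} (hp : p ∈ K) (hq : q ∈ K)
    (hpm : ∀ w ∈ K, orbitNorm π p ≤ orbitNorm π w) (hqp : orbitNorm π q ≤ orbitNorm π p) :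
    p = q := by
  have h := dist_le_of_almost_minimal hC1 hC hK (a := orbitNorm π p ^ 2)
    (b := orbitNorm π p ^ 2) (fun w hw => pow_le_pow_left₀ (nonneg _) (hpm w hw) 2) hp hq le_rfl
    (pow_le_pow_left₀ (nonneg _) hqp 2)
  rw [sub_self, mul_zero, Real.sqrt_zero, mul_zero] at h
  exact sub_eq_zero.1 (norm_le_zero_iff.1 h)

end orbitNorm

/-- The contragredient representation `g ↦ π(g⁻¹)*`. -/
noncomputable def contragredient [CompleteSpace H] (π : Γ →* (H →L[ℂ] H)) :
    Γ →* (H →L[ℂ] H) where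
  toFun g := ContinuousLinearMap.adjoint (π g⁻¹)
  map_one' := by
    rw [inv_one, map_one]
    exact ContinuousLinearMap.adjoint_id
  map_mul' g h := by
    rw [mul_inv_rev, map_mul]
    exact ContinuousLinearMap.adjoint_comp _ _

theorem contragredient_apply [CompleteSpace H] (π : Γ →* (H →L[ℂ] H)) (g : Γ) :
    contragredient π g = ContinuousLinearMap.adjoint (π g⁻¹) := rfl

theorem norm_contragredient_le [CompleteSpace H] {π : Γ →* (H →L[ℂ] H)} {C : ℝ}
    (hC : ∀ g, ‖π g‖ ≤ C) (g : Γ) :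
    ‖contragredient π g‖ ≤ C := by
  rw [contragredient_apply, LinearIsometryEquiv.norm_map]
  exact hC _

/-! ### The projection onto continuous vectors. -/

section Continuity

variable [TopologicalSpace Γ]

/-- The vectors whose orbit map is continuous at the identity. -/
def IsContinuousVector (π : Γ →* (H →L[ℂ] H)) (z : H) : Prop :=
  Tendsto (fun g => π g z) (𝓝 1) (𝓝 z)

variable {π : Γ →* (H →L[ℂ] H)} {C : ℝ}

/-- The preimage under `f` of a small closed disc about `f z` is a closed convex set containing `π g
z` for `g` near `1`. -/
theorem eq_of_forall_convex_mem {z p : H}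
    (hp : ∀ K : Set H, IsClosed K → Convex ℝ K → (∀ᶠ g in 𝓝 (1 : Γ), π g z ∈ K) → p ∈ K)
    (f : H →L[ℂ] ℂ) (hf : Tendsto (fun g => f (π g z)) (𝓝 1) (𝓝 (f z))) : f p = f z := by
  refine dist_le_zero.1 (le_of_forall_pos_le_add fun ε hε => ?_)
  rw [zero_add]
  refine hp (f ⁻¹' Metric.closedBall (f z) ε) (Metric.isClosed_closedBall.preimage f.continuous)
    ?_ ?_
  · exact (convex_closedBall (f z) ε).linear_preimage ((f : H →ₗ[ℂ] ℂ).restrictScalars ℝ)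
  · exact (Metric.tendsto_nhds.1 hf ε hε).mono fun g hg => hg.le

variable [IsTopologicalGroup Γ]

/-- The vector `p` is the asymptotic minimiser of the convex hulls of `π(U) z`, as `U` shrinks to
the identity. An almost minimal `w` in the hull for `W`, where `W * W ⊆ U`, is moved by `g ∈ W` to
an equally almost minimal point of the hull for `U`, so uniform convexity forces `π g w` to be near
`w`. -/
theorem exists_isContinuousVector [CompleteSpace H] (hC1 : 1 ≤ C) (hC : ∀ g, ‖π g‖ ≤ C) (z : H) :
    ∃ p, IsContinuousVector π p ∧
      ∀ K : Set H, IsClosed K → Convex ℝ K → (∀ᶠ g in 𝓝 (1 : Γ), π g z ∈ K) → p ∈ K := by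
  let K : {U : Set Γ // U ∈ 𝓝 (1 : Γ)} → Set H :=
    fun U => convexHull ℝ ((fun g => π g z) '' U)
  have : Nonempty {U : Set Γ // U ∈ 𝓝 (1 : Γ)} := ⟨⟨Set.univ, univ_mem⟩⟩
  have hdir : Directed (· ⊇ ·) K := fun U W =>
    ⟨⟨U ∩ W, inter_mem U.2 W.2⟩, convexHull_mono (Set.image_mono Set.inter_subset_left),
      convexHull_mono (Set.image_mono Set.inter_subset_right)⟩
  obtain ⟨ρ, p, h1, h2⟩ := orbitNorm.exists_limit hC1 hC K (fun U => convex_convexHull ℝ _) hdir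
    (orbitNorm π z ^ 2) (fun U => ⟨z, subset_convexHull ℝ _
      ⟨1, mem_of_mem_nhds U.2, by simp⟩, le_rfl⟩)
  refine ⟨p, ?_, fun S hcl hS hev => ?_⟩
  · refine Metric.tendsto_nhds.2 fun η hη => ?_
    have hδ : Tendsto (fun ε : ℝ => (C + 1) * ε + C * √(4 * (ρ + ε - (ρ - ε)))) (𝓝[>] 0)
        (𝓝 0) := by
      have : Continuous fun ε : ℝ => (C + 1) * ε + C * √(4 * (ρ + ε - (ρ - ε))) := by fun_prop
      have h := this.tendsto 0
      simp only [mul_zero, add_zero, sub_zero, sub_self, Real.sqrt_zero] at h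
      exact h.mono_left nhdsWithin_le_nhds
    obtain ⟨ε, hεη, hε⟩ := ((hδ.eventually (gt_mem_nhds hη)).and self_mem_nhdsWithin).exists
    obtain ⟨U, hU⟩ := h1 ε hε
    obtain ⟨W, hW, hWU⟩ := exists_nhds_one_split U.2
    obtain ⟨w, hw, hwp, hwρ⟩ := h2 ⟨W, hW⟩ ε hε
    filter_upwards [hW] with g hg
    have hwU : w ∈ K U := by
      refine convexHull_mono (Set.image_mono fun h hh => ?_) hw
      simpa using hWU 1 (mem_of_mem_nhds hW) h hh
    have hgw : π g w ∈ K U := by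
      have h3 : π g w ∈ (π g : H →ₗ[ℂ] H).restrictScalars ℝ ''
          convexHull ℝ ((fun h => π h z) '' W) := ⟨w, hw, rfl⟩
      rw [LinearMap.image_convexHull] at h3
      refine convexHull_mono ?_ h3
      rintro _ ⟨_, ⟨h, hh, rfl⟩, rfl⟩
      exact ⟨g * h, hWU g hg h hh, by simp⟩
    have h4 := orbitNorm.dist_le_of_almost_minimal hC1 hC (convex_convexHull ℝ _) hU hgw hwU
      (by rwa [orbitNorm.apply]) hwρ
    have h5 : ‖π g p - p‖ ≤ ‖π g (w - p)‖ + ‖π g w - w‖ + ‖w - p‖ := by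
      have : π g p - p = -(π g (w - p)) + (π g w - w) + (w - p) := by
        rw [map_sub]; abel
      rw [this]
      refine (norm_add₃_le).trans ?_
      rw [norm_neg]
    have h6 : ‖π g (w - p)‖ ≤ C * ε :=
      ((π g).le_of_opNorm_le (hC g) _).trans (mul_le_mul_of_nonneg_left hwp.le (by linarith))
    rw [dist_eq_norm]
    linarith
  · rw [← hcl.closure_eq, Metric.mem_closure_iff]
    intro ε hε
    obtain ⟨w, hw, h, _⟩ := h2 ⟨_, hev⟩ ε hε
    refine ⟨w, ?_, by rwa [dist_comm, dist_eq_norm]⟩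
    refine convexHull_min ?_ hS hw
    rintro _ ⟨g, hg, rfl⟩
    exact hg

theorem IsContinuousVector.apply {z : H} (hz : IsContinuousVector π z) (h : Γ) :
    IsContinuousVector π (π h z) := by
  have h1 : Tendsto (fun g : Γ => h⁻¹ * g * h) (𝓝 1) (𝓝 1) := by
    have : Continuous fun g : Γ => h⁻¹ * g * h := by fun_prop
    simpa using this.tendsto 1
  have h2 := ((π h).continuous.tendsto z).comp (Tendsto.comp hz h1)
  refine h2.congr fun g => ?_
  simp only [Function.comp_apply, ← mul_apply_eq_comp, ← map_mul]
  congr 2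
  group

theorem IsContinuousVector.comp_inv {z : H} (hz : IsContinuousVector π z) :
    Tendsto (fun g => π g⁻¹ z) (𝓝 1) (𝓝 z) := by
  have h1 : Tendsto (fun g : Γ => g⁻¹) (𝓝 1) (𝓝 1) := by
    simpa using (continuous_inv (G := Γ)).tendsto 1
  exact Tendsto.comp hz h1

/-- The projection onto the continuous vectors of a bounded representation on Hilbert space. -/
theorem exists_continuousVector_projection [CompleteSpace H] (hC1 : 1 ≤ C)
    (hC : ∀ g, ‖π g‖ ≤ C) :
    ∃ P : H →L[ℂ] H, (∀ z, IsContinuousVector π (P z)) ∧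
      (∀ z, ∀ f : H →L[ℂ] ℂ, Tendsto (fun g => f (π g z)) (𝓝 1) (𝓝 (f z)) → f (P z) = f z) ∧
      (∀ z, IsContinuousVector π z → P z = z) ∧ ∀ g z, P (π g z) = π g (P z) := by
  have hC' := norm_contragredient_le hC
  choose P hPc hPK using exists_isContinuousVector hC1 hC
  have hPf : ∀ z, ∀ f : H →L[ℂ] ℂ,
      Tendsto (fun g => f (π g z)) (𝓝 1) (𝓝 (f z)) → f (P z) = f z :=
    fun z f hf => eq_of_forall_convex_mem (hPK z) f hf
  have hadd {x y : H} (hx : IsContinuousVector π x) (hy : IsContinuousVector π y) :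
      IsContinuousVector π (x + y) := by
    simpa [IsContinuousVector] using Tendsto.add hx hy
  have hsmul (c : ℂ) {x : H} (hx : IsContinuousVector π x) : IsContinuousVector π (c • x) := by
    simpa [IsContinuousVector] using Tendsto.const_smul hx c
  -- A continuous vector `q` of the contragredient makes `g ↦ ⟪q, π g z⟫` continuous at `1`, so it
  -- does not see the difference between `z` and `P z`.
  have hPq (z q : H) (hq : IsContinuousVector (contragredient π) q) :
      inner ℂ q (P z) = inner ℂ q z := by
    refine hPf z (innerSL ℂ q) ?_
    have h := (hq.comp_inv).inner (𝕜 := ℂ) (tendsto_const_nhds (x := z))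
    refine h.congr fun g => ?_
    rw [contragredient_apply, inv_inv, ContinuousLinearMap.adjoint_inner_left]
    rfl
  -- Continuous vectors of the contragredient separate those of `π`: for `r = x - y`, smoothing `r`
  -- under the contragredient gives `q` with `⟪r, q⟫ = ⟪r, r⟫`. Linearity and equivariance of `P`
  -- follow from this uniqueness.
  have huniq (x y : H) (hx : IsContinuousVector π x) (hy : IsContinuousVector π y)
      (h : ∀ q, IsContinuousVector (contragredient π) q → inner ℂ q x = inner ℂ q y) :
      x = y := by
    have hr : IsContinuousVector π (x - y) := by
      have := hadd hx (hsmul (-1) hy)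
      rwa [neg_one_smul, ← sub_eq_add_neg] at this
    obtain ⟨q, hq, hqK⟩ := exists_isContinuousVector hC1 hC' (x - y)
    have h1 := eq_of_forall_convex_mem hqK (innerSL ℂ (x - y)) (by
      have h := (hr.comp_inv).inner (𝕜 := ℂ) (tendsto_const_nhds (x := x - y))
      refine h.congr fun g => ?_
      rw [contragredient_apply, innerSL_apply_apply, ContinuousLinearMap.adjoint_inner_right])
    rw [innerSL_apply_apply, innerSL_apply_apply, ← inner_conj_symm, inner_sub_right, h q hq,
      sub_self, map_zero] at h1
    exact sub_eq_zero.1 (inner_self_eq_zero.1 h1.symm)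
  let PL : H →ₗ[ℂ] H :=
    { toFun := P
      map_add' := fun x y => huniq _ _ (hPc _) (hadd (hPc _) (hPc _)) fun q hq => by
        rw [hPq _ q hq, inner_add_right, inner_add_right, hPq _ q hq, hPq _ q hq]
      map_smul' := fun c x => huniq _ _ (hPc _) (hsmul c (hPc _)) fun q hq => by
        rw [RingHom.id_apply, hPq _ q hq, inner_smul_right, inner_smul_right, hPq _ q hq] }
  have hbound (z : H) : ‖PL z‖ ≤ C * ‖z‖ := by
    have := hPK z (Metric.closedBall 0 (C * ‖z‖)) Metric.isClosed_closedBall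
      (convex_closedBall _ _) (Eventually.of_forall fun g => by
        rw [mem_closedBall_zero_iff]
        exact (π g).le_of_opNorm_le (hC g) z)
    rwa [mem_closedBall_zero_iff] at this
  refine ⟨PL.mkContinuous C hbound, hPc, hPf, fun z hz => ?_, fun g z => ?_⟩
  · exact huniq _ _ (hPc z) hz fun q hq => hPq z q hq
  · refine huniq _ _ (hPc _) ((hPc z).apply g) fun q hq => ?_
    have h1 (w : H) : inner ℂ q (π g w) = inner ℂ (contragredient π g⁻¹ q) w := by
      rw [contragredient_apply, inv_inv, ContinuousLinearMap.adjoint_inner_left]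
    change inner ℂ q (P (π g z)) = inner ℂ q (π g (P z))
    rw [hPq _ q hq, h1, h1, hPq _ _ (hq.apply g⁻¹)]

theorem continuous_orbit (h : ∀ z, IsContinuousVector π z) (z : H) :
    Continuous fun g => π g z := by
  refine continuous_iff_continuousAt.2 fun a => ?_
  have h1 : Tendsto (fun g : Γ => a⁻¹ * g) (𝓝 a) (𝓝 1) := by
    have : Continuous fun g : Γ => a⁻¹ * g := by fun_prop
    simpa using this.tendsto a
  refine (((π a).continuous.tendsto z).comp (Tendsto.comp (h z) h1)).congr fun g => ?_
  simp only [Function.comp_apply, ← mul_apply_eq_comp, ← map_mul]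
  congr 2
  group

end Continuity

end BoundedRepresentation

/-! ### Coordinates and automorphisms of the regular tree. -/

namespace TreeDerivation

variable {V : Type*} {T : SimpleGraph V}

theorem hat_eq_or_hat_eq (hT : T.IsTree) (s : V) {a b : V} (h : T.Adj a b) :
    (a ≠ s ∧ hat hT s a = b) ∨ (b ≠ s ∧ hat hT s b = a) := by
  by_cases hb : b ∈ (geod hT s a).support
  · refine Or.inl ⟨?_, (hT.isAcyclic.eq_penultimate_of_adj_end (geod_isPath hT s a) h hb).symm⟩
    rintro rfl
    have h0 : (SimpleGraph.Walk.nil : T.Walk a a) = geod hT a a := eq_geod hT _ (by simp)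
    rw [← h0, SimpleGraph.Walk.support_nil, List.mem_singleton] at hb
    exact h.ne hb.symm
  · refine Or.inr ⟨?_, ?_⟩
    · rintro rfl
      exact hb (SimpleGraph.Walk.start_mem_support _)
    · rw [hat, ← eq_geod hT _ ((geod_isPath hT s a).concat hb h),
        SimpleGraph.Walk.penultimate_concat]

theorem adj_iff_hat (hT : T.IsTree) (s : V) {a b : V} :
    T.Adj a b ↔ (a ≠ s ∧ hat hT s a = b) ∨ (b ≠ s ∧ hat hT s b = a) := by
  refine ⟨hat_eq_or_hat_eq hT s, ?_⟩
  rintro (⟨h, rfl⟩ | ⟨h, rfl⟩)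
  · exact (adj_hat hT h).symm
  · exact adj_hat hT h

theorem length_geod_hat (hT : T.IsTree) {s t : V} (h : t ≠ s) :
    (geod hT s (hat hT s t)).length + 1 = (geod hT s t).length := by
  have h1 := eq_geod hT _ (geod_isPath hT s t).dropLast
  change (geod hT s (geod hT s t).penultimate).length + 1 = _
  rw [← h1]
  exact SimpleGraph.Walk.length_dropLast_add_one (SimpleGraph.Walk.not_nil_of_ne h.symm)

/-- Coordinates on a regular tree: vertices are finite sequences, the root `s` is the empty one,
and deleting the head is `t ↦ t̂`. -/
structure IsCoordinates (hT : T.IsTree) (s : V) (f : List ℕ ≃ V) : Prop where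
  nil : f [] = s
  cons_ne : ∀ n l, f (n :: l) ≠ s
  hat_cons : ∀ n l, hat hT s (f (n :: l)) = f l

theorem exists_isCoordinates [Countable V] (hT : T.IsTree)
    (hdeg : ∀ v : V, (T.neighborSet v).Infinite) (s : V) :
    ∃ f : List ℕ ≃ V, IsCoordinates hT s f := by
  -- Every neighbour of `a` other than its parent is a child. For `a = s` nothing is lost, as the
  -- root is its own `hat` and not its own neighbour.
  have hinf (a : V) : Infinite {t : V // t ≠ s ∧ hat hT s t = a} := by
    refine Set.infinite_coe_iff.2 (((hdeg a).sdiff (Set.finite_singleton (hat hT s a))).mono ?_)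
    rintro t ⟨ht, hta⟩
    rcases hat_eq_or_hat_eq hT s ht with h | h
    · exact absurd h.2.symm hta
    · exact h
  have hequiv (a : V) : Nonempty (ℕ ≃ {t : V // t ≠ s ∧ hat hT s t = a}) :=
    nonempty_equiv_of_countable
  let κ (a : V) := (hequiv a).some
  let F : List ℕ → V := fun l => l.rec s fun n _ a => (κ a n : V)
  have hcons (n : ℕ) (l : List ℕ) : F (n :: l) = κ (F l) n := rfl
  have hne (n : ℕ) (l : List ℕ) : F (n :: l) ≠ s := (κ (F l) n).2.1
  have hhat (n : ℕ) (l : List ℕ) : hat hT s (F (n :: l)) = F l := (κ (F l) n).2.2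
  have hinj : Function.Injective F := by
    intro l
    induction l with
    | nil =>
      rintro (_ | ⟨n, l⟩) h
      · rfl
      · exact absurd h.symm (hne n l)
    | cons n l ih =>
      rintro (_ | ⟨n', l'⟩) h
      · exact absurd h (hne n l)
      · obtain rfl : l = l' := ih (by rw [← hhat n l, h, hhat])
        rw [hcons, hcons] at h
        rw [(κ (F l)).injective (Subtype.ext h)]
  have hsurj : ∀ (m : ℕ) (t : V), (geod hT s t).length = m → ∃ l, F l = t := by
    intro m
    induction m with
    | zero => exact fun t ht => ⟨[], SimpleGraph.Walk.eq_of_length_eq_zero ht⟩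
    | succ m ih =>
      intro t ht
      have hts : t ≠ s := by
        rintro rfl
        have h0 : (SimpleGraph.Walk.nil : T.Walk t t) = geod hT t t := eq_geod hT _ (by simp)
        rw [← h0] at ht
        simp at ht
      obtain ⟨l, hl⟩ := ih (hat hT s t) (by have := length_geod_hat hT hts; omega)
      refine ⟨(κ (F l)).symm ⟨t, hts, hl.symm⟩ :: l, ?_⟩
      rw [hcons, Equiv.apply_symm_apply]
  exact ⟨Equiv.ofBijective F ⟨hinj, fun t => hsurj _ t rfl⟩, rfl, hne, hhat⟩

namespace IsCoordinates

variable {hT : T.IsTree} {s s' : V} {f f' : List ℕ ≃ V}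

theorem adj_iff (hf : IsCoordinates hT s f) (l l' : List ℕ) :
    T.Adj (f l) (f l') ↔ (∃ n, l = n :: l') ∨ ∃ n, l' = n :: l := by
  have key (a b : List ℕ) : (f a ≠ s ∧ hat hT s (f a) = f b) ↔ ∃ n, a = n :: b := by
    constructor
    · rintro ⟨h1, h2⟩
      rcases a with _ | ⟨n, a⟩
      · exact absurd hf.nil h1
      · rw [hf.hat_cons] at h2
        exact ⟨n, by rw [f.injective h2]⟩
    · rintro ⟨n, rfl⟩
      exact ⟨hf.cons_ne n b, hf.hat_cons n b⟩
  rw [adj_iff_hat hT s, key, key]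

/-- The automorphism mapping one system of coordinates to another, permuting the letters. -/
def iso (hf : IsCoordinates hT s f) (hf' : IsCoordinates hT s' f') (σ : Equiv.Perm ℕ) :
    T ≃g T where
  toEquiv := (f.symm.trans (Equiv.listEquivOfEquiv σ)).trans f'
  map_rel_iff' {a b} := by
    obtain ⟨l, rfl⟩ := f.surjective a
    obtain ⟨l', rfl⟩ := f.surjective b
    have key (a b : List ℕ) : (∃ n, a.map σ = n :: b.map σ) ↔ ∃ n, a = n :: b := by
      constructor
      · rintro ⟨n, h⟩
        rcases a with _ | ⟨m, a⟩
        · simp at h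
        · rw [List.map_cons, List.cons.injEq] at h
          exact ⟨m, by rw [List.map_injective_iff.2 σ.injective h.2]⟩
      · rintro ⟨n, rfl⟩
        exact ⟨σ n, rfl⟩
    simp only [Equiv.trans_apply, Equiv.symm_apply_apply]
    change T.Adj (f' (l.map σ)) (f' (l'.map σ)) ↔ _
    rw [hf.adj_iff, hf'.adj_iff, key, key]

theorem iso_apply_root (hf : IsCoordinates hT s f) (hf' : IsCoordinates hT s' f')
    (σ : Equiv.Perm ℕ) : hf.iso hf' σ s = s' := by
  have h : f.symm s = [] := by rw [f.symm_apply_eq, hf.nil]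
  change f' ((f.symm s).map σ) = s'
  rw [h, List.map_nil, hf'.nil]

theorem iso_apply (hf : IsCoordinates hT s f) (hf' : IsCoordinates hT s' f') (σ : Equiv.Perm ℕ)
    (l : List ℕ) : hf.iso hf' σ (f l) = f' (l.map σ) := by
  change f' ((f.symm (f l)).map σ) = _
  rw [Equiv.symm_apply_apply]

end IsCoordinates

section Automorphisms

variable [Countable V] (hT : T.IsTree) (hdeg : ∀ v : V, (T.neighborSet v).Infinite)
include hT hdeg

/-- Neighbours of the root are the one-letter lists, and a transposition of letters carries any one
to any other. -/
theorem exists_iso_of_adj {s t s' t' : V} (h : T.Adj s t) (h' : T.Adj s' t') :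
    ∃ g : T ≃g T, g s = s' ∧ g t = t' := by
  obtain ⟨f, hf⟩ := exists_isCoordinates hT hdeg s
  obtain ⟨f', hf'⟩ := exists_isCoordinates hT hdeg s'
  have key {s t : V} {f : List ℕ ≃ V} (hf : IsCoordinates hT s f) (h : T.Adj s t) :
      ∃ n, f [n] = t := by
    obtain ⟨l, rfl⟩ := f.surjective t
    rw [← hf.nil, hf.adj_iff] at h
    rcases h with ⟨n, hn⟩ | ⟨n, rfl⟩
    · simp at hn
    · exact ⟨n, rfl⟩
  obtain ⟨n, rfl⟩ := key hf h
  obtain ⟨n', rfl⟩ := key hf' h'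
  refine ⟨hf.iso hf' (Equiv.swap n n'), hf.iso_apply_root hf' _, ?_⟩
  rw [hf.iso_apply]
  simp

theorem exists_iso_apply_eq (s s' : V) : ∃ g : T ≃g T, g s = s' := by
  obtain ⟨t, ht⟩ := (hdeg s).nonempty
  obtain ⟨t', ht'⟩ := (hdeg s').nonempty
  obtain ⟨g, hg, _⟩ := exists_iso_of_adj hT hdeg ht ht'
  exact ⟨g, hg⟩

/-- Letter permutations fix the root, the empty list; transpositions send the head of a nonempty
list to any prescribed letter. -/
theorem infinite_orbit_stabilizer {s t : V} (h : t ≠ s) :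
    {t' : V | ∃ g : T ≃g T, g s = s ∧ g t = t'}.Infinite := by
  obtain ⟨f, hf⟩ := exists_isCoordinates hT hdeg s
  obtain ⟨_ | ⟨n, l⟩, rfl⟩ := f.surjective t
  · exact absurd hf.nil h
  · have hinj : Function.Injective fun m => f ((n :: l).map (Equiv.swap n m)) := by
      intro a b hab
      have := f.injective hab
      simp only [List.map_cons, Equiv.swap_apply_left, List.cons.injEq] at this
      exact this.1
    refine (Set.infinite_range_of_injective hinj).mono ?_
    rintro _ ⟨m, rfl⟩
    exact ⟨hf.iso hf (Equiv.swap n m), hf.iso_apply_root hf _, hf.iso_apply hf _ _⟩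

end Automorphisms

theorem eq_zero_of_infinite (x : Ell V 2) (c : ℂ) {S : Set V} (hS : S.Infinite)
    (h : ∀ t ∈ S, x t = c) : c = 0 := by
  by_contra hc
  have h1 := ((lp.memℓp x).summable (by simp)).tendsto_cofinite_zero
  have h2 : (0 : ℝ) < ‖c‖ ^ (2 : ℝ≥0∞).toReal := by positivity
  refine hS (Set.Finite.subset (h1.eventually (gt_mem_nhds h2)) fun t ht hlt => ?_)
  simp only [Set.mem_ofPred_eq, h t ht, lt_self_iff_false] at hlt

open Classical in
theorem lam_single (p : ℝ≥0∞) [Fact (1 ≤ p)] (g : T ≃g T) (s : V) (a : ℂ) :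
    lam p g (lp.single p s a : Ell V p) = lp.single p (g s) a := by
  ext t
  rw [lam_apply, lp.single_apply, lp.single_apply]
  simp only [Pi.single_apply, g.symm_apply_eq]

theorem lam_apply_apply (p : ℝ≥0∞) [Fact (1 ≤ p)] (g : T ≃g T) (x : Ell V p) (t : V) :
    lam p g x (g t) = x t := by
  rw [lam_apply, g.symm_apply_apply]

/-! ### Irreducibility of the shift and non-innerness of the derivation. -/

section Rigidity

variable [Countable V] (hT : T.IsTree) (hdeg : ∀ v : V, (T.neighborSet v).Infinite)
include hT hdeg

/-- The shift representation on `ℓ_2(T)` is irreducible: its commutant is trivial. -/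
theorem eq_smul_of_commute_lam [Nonempty V] (c : Ell V 2 →L[ℂ] Ell V 2)
    (hc : ∀ (g : T ≃g T) x, c (lam 2 g x) = lam 2 g (c x)) : ∃ γ : ℂ, ∀ x, c x = γ • x := by
  classical
  obtain ⟨e⟩ := ‹Nonempty V›
  -- The image of the Dirac function at `s` is constant on orbits of the stabiliser of `s`, which
  -- are infinite away from `s`.
  have hoff (s t : V) (h : t ≠ s) : c (lp.single 2 s (1 : ℂ)) t = 0 := by
    refine eq_zero_of_infinite (c (lp.single 2 s (1 : ℂ))) _
      (infinite_orbit_stabilizer hT hdeg h) ?_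
    rintro _ ⟨g, hg, rfl⟩
    have h1 := hc g (lp.single 2 s 1)
    rw [lam_single, hg] at h1
    conv_lhs => rw [h1]
    exact lam_apply_apply 2 g _ t
  refine ⟨c (lp.single 2 e (1 : ℂ)) e, fun x => ?_⟩
  suffices h : c = (c (lp.single 2 e (1 : ℂ)) e) • ContinuousLinearMap.id ℂ (Ell V 2) by
    conv_lhs => rw [h]
    rfl
  refine lp.ext_continuousLinearMap (by simp) fun s => ContinuousLinearMap.ext_ring ?_
  ext t
  change c (lp.single 2 s (1 : ℂ)) t =
    c (lp.single 2 e (1 : ℂ)) e * (lp.single 2 s (1 : ℂ) : Ell V 2) t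
  by_cases h : t = s
  · subst h
    obtain ⟨g, rfl⟩ := exists_iso_apply_eq hT hdeg e t
    rw [← lam_single, hc, lam_apply_apply, lam_apply_apply]
    simp
  · rw [hoff s t h, lp.single_apply_ne _ _ _ h, mul_zero]

/-- The derivation `d` is not inner. -/
theorem d_not_inner (e : V) (b : Ell V 2 →L[ℂ] Ell V 2)
    (hb : ∀ (g : T ≃g T) x, d hT e g x = b (lam 2 g x) - lam 2 g (b x)) : False := by
  classical
  -- `B` is the matrix of `L*`. If `d` is inner via `b`, then `D`, the matrix of `b - L*`, is
  -- invariant under automorphisms, hence constant on oriented edges.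
  let B (s t : V) : ℂ := if t = e then 0 else (lp.single 2 s (1 : ℂ) : Ell V 2) (hat hT e t)
  let D (s t : V) : ℂ := b (lp.single 2 s (1 : ℂ)) t - B s t
  have hD (g : T ≃g T) (s t : V) : D (g s) (g t) = D s t := by
    have h1 := congrArg (fun y : Ell V 2 => y (g t)) (hb g (lp.single 2 s (1 : ℂ)))
    have h2 : (lp.single 2 s (1 : ℂ) : Ell V 2) (g.symm (hat hT e (g t))) =
        (lp.single 2 (g s) (1 : ℂ) : Ell V 2) (hat hT e (g t)) := by
      rw [← lam_single, lam_apply]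
    simp only [d_apply, h2, g.symm_apply_apply, lam_single, lp.coeFn_sub, Pi.sub_apply,
      lam_apply_apply] at h1
    simp only [D, B]
    linear_combination -h1
  obtain ⟨t₀, ht₀⟩ := (hdeg e).nonempty
  have hadj {s t : V} (h : T.Adj s t) : D s t = D e t₀ := by
    obtain ⟨g, rfl, rfl⟩ := exists_iso_of_adj hT hdeg ht₀ h
    exact hD g e t₀
  -- Square summability of `b 1_e` over the neighbours of `e` forces the edge constant to be `-1`,
  -- since `L*` contributes `1` on edges leaving the root.
  have h1 : D e t₀ + 1 = 0 := by
    refine eq_zero_of_infinite (b (lp.single 2 e (1 : ℂ))) _ (hdeg e) fun t ht => ?_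
    have hat_t : hat hT e t = e := by
      rcases hat_eq_or_hat_eq hT e ht with h | h
      · exact absurd rfl h.1
      · exact h.2
    rw [← hadj ht]
    simp [D, B, hat_t, (T.ne_of_adj ht).symm]
  -- On edges entering the root `L*` contributes `0`, so the adjoint of `b` maps `1_e` to a function
  -- equal to `-1` at all neighbours of `e`.
  have h2 : (-1 : ℂ) = 0 := by
    refine eq_zero_of_infinite
      (ContinuousLinearMap.adjoint b (lp.single 2 e (1 : ℂ))) _ (hdeg e) fun s hs => ?_
    have h3 := ContinuousLinearMap.adjoint_inner_right b (lp.single 2 s (1 : ℂ))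
      (lp.single 2 e (1 : ℂ))
    rw [lp.inner_single_left, lp.inner_single_right] at h3
    have h4 : b (lp.single 2 s (1 : ℂ)) e = -1 := by
      have h5 : D s e = -1 := by
        rw [hadj (T.adj_symm hs)]
        linear_combination h1
      simpa only [D, B, if_true, sub_zero] using h5
    rw [h4] at h3
    simpa using h3
  simp at h2

/-- Bounded idempotents commuting with `λ_d` are trivial. -/
theorem eq_zero_or_one_of_commute_lamD (e : V) (P : (Ell V 2 × Ell V 2) →L[ℂ] (Ell V 2 × Ell V 2))
    (hP : ∀ g z, P (lamD hT e g z) = lamD hT e g (P z)) (hPP : ∀ z, P (P z) = P z) :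
    (∀ z, P z = 0) ∨ ∀ z, P z = z := by
  have : Nonempty V := ⟨e⟩
  let inl := ContinuousLinearMap.inl ℂ (Ell V 2) (Ell V 2)
  let inr := ContinuousLinearMap.inr ℂ (Ell V 2) (Ell V 2)
  let fst := ContinuousLinearMap.fst ℂ (Ell V 2) (Ell V 2)
  let snd := ContinuousLinearMap.snd ℂ (Ell V 2) (Ell V 2)
  have hl (g : T ≃g T) (x : Ell V 2) : P (lam 2 g x, 0) =
      (lam 2 g (P (x, 0)).1 + d hT e g (P (x, 0)).2, lam 2 g (P (x, 0)).2) := by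
    have := hP g (x, 0)
    rwa [lamD_apply, map_zero, map_zero, add_zero] at this
  have hr (g : T ≃g T) (y : Ell V 2) : P (d hT e g y, 0) + P (0, lam 2 g y) =
      (lam 2 g (P (0, y)).1 + d hT e g (P (0, y)).2, lam 2 g (P (0, y)).2) := by
    have := hP g (0, y)
    rw [lamD_apply, map_zero, zero_add] at this
    rw [← map_add, Prod.mk_add_mk, add_zero, zero_add, this]
    rfl
  obtain ⟨γ, hγ⟩ := eq_smul_of_commute_lam hT hdeg (snd ∘L P ∘L inl) fun g x =>
    congrArg Prod.snd (hl g x)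
  replace hγ : ∀ x, (P (x, 0)).2 = γ • x := hγ
  -- The lower left block is a scalar `γ`. If it were nonzero, the lower right block divided by `-γ`
  -- would implement `d`.
  have hγ0 : γ = 0 := by
    by_contra h
    refine d_not_inner hT hdeg e (-γ⁻¹ • (snd ∘L P ∘L inr)) fun g y => ?_
    have h1 : γ • d hT e g y + (P (0, lam 2 g y)).2 = lam 2 g (P (0, y)).2 := by
      rw [← hγ]
      exact congrArg Prod.snd (hr g y)
    change d hT e g y = -γ⁻¹ • (P (0, lam 2 g y)).2 - lam 2 g (-γ⁻¹ • (P (0, y)).2)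
    rw [map_smul, ← smul_sub, ← h1, sub_add_cancel_right, smul_neg, neg_smul, neg_neg, smul_smul,
      inv_mul_cancel₀ h, one_smul]
  subst hγ0
  simp only [zero_smul] at hγ
  obtain ⟨α, hα⟩ := eq_smul_of_commute_lam hT hdeg (fst ∘L P ∘L inl) fun g x => by
    have := congrArg Prod.fst (hl g x)
    rwa [hγ, map_zero, add_zero] at this
  replace hα : ∀ x, (P (x, 0)).1 = α • x := hα
  obtain ⟨β, hβ⟩ := eq_smul_of_commute_lam hT hdeg (snd ∘L P ∘L inr) fun g y => by
    have := congrArg Prod.snd (hr g y)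
    rwa [Prod.snd_add, hγ, zero_add] at this
  replace hβ : ∀ y, (P (0, y)).2 = β • y := hβ
  have h1 (g : T ≃g T) (y : Ell V 2) : α • d hT e g y + (P (0, lam 2 g y)).1 =
      lam 2 g (P (0, y)).1 + β • d hT e g y := by
    have := congrArg Prod.fst (hr g y)
    rwa [Prod.fst_add, hα, hβ, map_smul] at this
  -- If the diagonal scalars differed, the upper right block divided by `β - α` would implement `d`.
  have hαβ : β = α := by
    by_contra h
    have h' : β - α ≠ 0 := sub_ne_zero.2 h
    refine d_not_inner hT hdeg e ((β - α)⁻¹ • (fst ∘L P ∘L inr)) fun g y => ?_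
    change d hT e g y = (β - α)⁻¹ • (P (0, lam 2 g y)).1 - lam 2 g ((β - α)⁻¹ • (P (0, y)).1)
    have h2 : (P (0, lam 2 g y)).1 - lam 2 g (P (0, y)).1 = (β - α) • d hT e g y := by
      rw [sub_smul, sub_eq_sub_iff_add_eq_add, add_comm, h1, add_comm]
    rw [map_smul, ← smul_sub, h2, smul_smul, inv_mul_cancel₀ h', one_smul]
  subst hαβ
  -- With equal diagonal scalars the upper right block also commutes with the shift. So `P` is `β`
  -- plus `ν` times a square-zero operator, and idempotency gives `β ∈ {0, 1}`, `ν = 0`.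
  obtain ⟨ν, hν⟩ := eq_smul_of_commute_lam hT hdeg (fst ∘L P ∘L inr) fun g y => by
    have := h1 g y
    rw [add_comm] at this
    exact add_right_cancel this
  replace hν : ∀ y, (P (0, y)).1 = ν • y := hν
  have hform (x y : Ell V 2) : P (x, y) = (β • x + ν • y, β • y) := by
    have : ((x, y) : Ell V 2 × Ell V 2) = (x, 0) + (0, y) := by simp
    rw [this, map_add]
    refine Prod.ext ?_ ?_
    · rw [Prod.fst_add, hα, hν]
    · rw [Prod.snd_add, hγ, hβ, zero_add]
  classical
  have hone : (lp.single 2 e (1 : ℂ) : Ell V 2) e = 1 := lp.single_apply_self _ _ _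
  have h2 := hPP (0, lp.single 2 e 1)
  rw [hform, hform, smul_zero, zero_add] at h2
  have h3 := congrArg (fun z : Ell V 2 × Ell V 2 => z.2 e) h2
  have h4 := congrArg (fun z : Ell V 2 × Ell V 2 => z.1 e) h2
  simp only [lp.coeFn_smul, lp.coeFn_add, Pi.smul_apply, Pi.add_apply, hone, smul_eq_mul,
    mul_one] at h3 h4
  have h5 : β = 0 ∨ β = 1 := by
    have : β * (β - 1) = 0 := by linear_combination h3
    rcases mul_eq_zero.1 this with h | h
    · exact Or.inl h
    · exact Or.inr (sub_eq_zero.1 h)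
  rcases h5 with rfl | rfl
  · have : ν = 0 := by linear_combination -h4
    left
    rintro ⟨x, y⟩
    rw [hform, this]
    simp
  · have : ν = 0 := by linear_combination h4
    right
    rintro ⟨x, y⟩
    rw [hform, this]
    simp

end Rigidity

/-- `L + L*` is the adjacency operator, so `L λ(g) - λ(g) L = -d(g)` on `ℓ_1(T)`. -/
theorem ellIncl_L_lam (hT : T.IsTree) (e : V) (g : T ≃g T) (x : Ell V 1) :
    ellIncl V one_le_two (L hT e (lam 1 g x)) - lam 2 g (ellIncl V one_le_two (L hT e x)) =
      -d hT e g (ellIncl V one_le_two x) := by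
  classical
  ext t
  let ev (s : V) : Ell V 1 →L[ℂ] ℂ := lp.evalCLM ℂ (fun _ : V => ℂ) 1 s
  let A : Ell V 1 →L[ℂ] ℂ := ev t ∘L L hT e ∘L lam 1 g - ev (g.symm t) ∘L L hT e
  let B : Ell V 1 →L[ℂ] ℂ := (if t = e then 0 else ev (g.symm (hat hT e t))) -
    (if g.symm t = e then 0 else ev (hat hT e (g.symm t)))
  have hB (z : Ell V 1) : B z = (if t = e then 0 else z (g.symm (hat hT e t))) -
      (if g.symm t = e then 0 else z (hat hT e (g.symm t))) := by
    simp only [B, sub_apply]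
    congr 1 <;> split_ifs <;> rfl
  suffices h : A = -B by
    have h1 : A x = -B x := by rw [h]; rfl
    rw [hB] at h1
    exact h1
  -- For fixed `t` both sides are continuous functionals on `ℓ_1`, so Dirac functions suffice.
  refine lp.ext_continuousLinearMap (by simp) fun s => ContinuousLinearMap.ext_ring ?_
  change L hT e (lam 1 g (lp.single 1 s 1)) t - L hT e (lp.single 1 s 1) (g.symm t) =
    -B (lp.single 1 s 1)
  obtain ⟨r, rfl⟩ := g.surjective t
  have hL (a b : V) : L hT e (lp.single 1 a (1 : ℂ)) b = if a ≠ e ∧ hat hT e a = b then 1 else 0 := by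
    rw [L_single]
    by_cases h : a = e
    · simp [h]
    · by_cases h' : hat hT e a = b
      · subst h'
        simp [h]
      · rw [if_neg h, lp.single_apply_ne _ _ _ (Ne.symm h'), if_neg (fun hh => h' hh.2)]
  have hsingle (b c : V) : (if b = e then 0 else (lp.single 1 s (1 : ℂ) : Ell V 1) c) =
      if b ≠ e ∧ c = s then 1 else 0 := by
    by_cases h : b = e
    · simp [h]
    · by_cases h' : c = s
      · subst h'
        simp [h]
      · rw [if_neg h, lp.single_apply_ne _ _ _ h', if_neg (fun hh => h' hh.2)]
  -- The adjacency matrix is the sum of the matrices of `L` and `L*`: exactly one of two adjacent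
  -- vertices is the parent of the other, since distance to `e` rules out both.
  have hadj (a b : V) : ((if T.Adj a b then 1 else 0 : ℂ)) =
      (if a ≠ e ∧ hat hT e a = b then 1 else 0) + if b ≠ e ∧ hat hT e b = a then 1 else 0 := by
    by_cases h : a ≠ e ∧ hat hT e a = b
    · have h' : ¬(b ≠ e ∧ hat hT e b = a) := by
        rintro ⟨hb, hba⟩
        have h1 := length_geod_hat hT h.1
        have h2 := length_geod_hat hT hb
        rw [hba] at h2
        rw [h.2] at h1
        omega
      rw [if_pos h, if_neg h', if_pos ((adj_iff_hat hT e).2 (Or.inl h)), add_zero]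
    · rw [if_neg h, zero_add]
      simp only [adj_iff_hat hT e, h, false_or]
  have h1 := hadj (g s) (g r)
  rw [g.map_adj_iff, hadj s r] at h1
  rw [lam_single, hL, hL, hB, hsingle, hsingle, g.symm_apply_apply, g.symm_apply_eq]
  linear_combination -h1

end TreeDerivation

/-! ### Bounded groups of block triangular operators. -/

section BoundedSubgroup

open Filter Topology

variable {X : Type*} [NormedAddCommGroup X] [InnerProductSpace ℂ X]

/-- The action of `G ≤ GL(X ⊕ X)` on the Hilbert sum `X ⊕ X`. -/
noncomputable def hilbertRep (G : Subgroup (GLGroup (X × X))) :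
    G →* (WithLp 2 (X × X) →L[ℂ] WithLp 2 (X × X)) where
  toFun A := ((WithLp.prodContinuousLinearEquiv 2 ℂ X X).symm : X × X →L[ℂ] WithLp 2 (X × X)) ∘L
    (A.1 : X × X →L[ℂ] X × X) ∘L
    (WithLp.prodContinuousLinearEquiv 2 ℂ X X : WithLp 2 (X × X) →L[ℂ] X × X)
  map_one' := rfl
  map_mul' _ _ := rfl

theorem hilbertRep_apply (G : Subgroup (GLGroup (X × X))) (A : G) (z : WithLp 2 (X × X)) :
    hilbertRep G A z = (WithLp.prodContinuousLinearEquiv 2 ℂ X X).symm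
      (A.1 (WithLp.prodContinuousLinearEquiv 2 ℂ X X z)) := rfl

theorem exists_norm_hilbertRep_le {G : Subgroup (GLGroup (X × X))} (hG : IsBoundedSubgroup G) :
    ∃ C : ℝ, 1 ≤ C ∧ ∀ A, ‖hilbertRep G A‖ ≤ C := by
  obtain ⟨C, hC⟩ := hG
  let E := (WithLp.prodContinuousLinearEquiv 2 ℂ X X : WithLp 2 (X × X) →L[ℂ] X × X)
  let E' := ((WithLp.prodContinuousLinearEquiv 2 ℂ X X).symm : X × X →L[ℂ] WithLp 2 (X × X))
  refine ⟨max 1 (‖E'‖ * (C * ‖E‖)), le_max_left _ _, fun A => le_trans ?_ (le_max_right _ _)⟩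
  refine (ContinuousLinearMap.opNorm_comp_le E' _).trans ?_
  refine mul_le_mul_of_nonneg_left ?_ (norm_nonneg _)
  refine (ContinuousLinearMap.opNorm_comp_le _ E).trans ?_
  exact mul_le_mul_of_nonneg_right (hC A A.2) (norm_nonneg _)

theorem snd_apply_eq {A : GLGroup (X × X)} (hA : ∀ x, (A (x, 0)).2 = 0) (x y : X) :
    (A (x, y)).2 = (A (0, y)).2 := by
  have : ((x, y) : X × X) = (x, 0) + (0, y) := by simp
  rw [this, map_add, Prod.snd_add, hA, zero_add]

/-- A bounded group leaving the first summand of `X ⊕ X` invariant preserves the graph of a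
continuous homogeneous map, namely the nearest point map for an invariant norm. -/
theorem exists_invariant_graph [CompleteSpace X] {G : Subgroup (GLGroup (X × X))}
    (hG : IsBoundedSubgroup G) (hinv : ∀ A ∈ G, ∀ x : X, (A (x, 0)).2 = 0) :
    ∃ φ : X → X, Continuous φ ∧ (∀ (c : ℂ) x, φ (c • x) = c • φ x) ∧
      ∀ A ∈ G, ∀ y, A (φ y, y) = (φ (A (0, y)).2, (A (0, y)).2) := by
  obtain ⟨C, hC1, hC⟩ := exists_norm_hilbertRep_le hG
  set π := hilbertRep G with hπ
  let E := WithLp.prodContinuousLinearEquiv 2 ℂ X X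
  let N : X × X → ℝ := fun z => orbitNorm π (E.symm z)
  let K : X → Set (WithLp 2 (X × X)) := fun y => {w | (E w).2 = y}
  have hKc (y : X) : Convex ℝ (K y) :=
    (convex_singleton y).linear_preimage
      (((ContinuousLinearMap.snd ℂ X X ∘L (E : WithLp 2 (X × X) →L[ℂ] X × X)) :
        WithLp 2 (X × X) →ₗ[ℂ] X).restrictScalars ℝ)
  have hKcl (y : X) : IsClosed (K y) :=
    isClosed_singleton.preimage (continuous_snd.comp E.continuous)
  have hmem (x y : X) : E.symm (x, y) ∈ K y := by
    change (E (E.symm (x, y))).2 = y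
    rw [E.apply_symm_apply]
  choose p hpK hpmin using fun y =>
    orbitNorm.exists_minimal hC1 hC (hKc y) (hKcl y) ⟨_, hmem 0 y⟩
  let φ : X → X := fun y => (E (p y)).1
  have hp (y : X) : p y = E.symm (φ y, y) := by
    rw [E.eq_symm_apply]
    exact Prod.ext rfl (hpK y)
  have hmin (x y : X) : N (φ y, y) ≤ N (x, y) := by
    have := hpmin y _ (hmem x y)
    rwa [hp] at this
  have huniq (x y : X) (h : N (x, y) ≤ N (φ y, y)) : x = φ y := by
    have h1 := orbitNorm.minimal_unique hC1 hC (hKc y) (hpK y) (hmem x y) (hpmin y)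
      (by rw [hp]; exact h)
    rw [hp] at h1
    exact (congrArg Prod.fst (E.symm.injective h1)).symm
  have hNsmul (c : ℂ) (z : X × X) : N (c • z) = ‖c‖ * N z := by
    simp only [N, map_smul, orbitNorm.smul]
  have hNA (A : GLGroup (X × X)) (hA : A ∈ G) (z : X × X) : N (A z) = N z := by
    have := orbitNorm.apply (π := π) ⟨A, hA⟩ (E.symm z)
    rwa [hπ, hilbertRep_apply, ContinuousLinearEquiv.apply_symm_apply] at this
  have hNadd (z w : X × X) : N (z + w) ≤ N z + N w := by
    simp only [N, map_add]
    exact orbitNorm.add_le hC _ _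
  refine ⟨φ, ?_, fun c x => (huniq _ _ ?_).symm, fun A hA y => ?_⟩
  · refine continuous_iff_continuousAt.2 fun y => ?_
    let η : X → ℝ := fun y' => N (0, y - y')
    have hη : Continuous η :=
      (orbitNorm.continuous hC).comp (E.symm.continuous.comp (by fun_prop))
    have hη0 : η y = 0 := by
      have := hNsmul 0 (0, y - y)
      rw [norm_zero, zero_mul, zero_smul] at this
      change N (0, y - y) = 0
      rw [sub_self]
      exact this
    have hη' (y' : X) : N (0, y' - y) = η y' := by
      have := hNsmul (-1) (0, y - y')
      simpa [η] using this
    -- Moving between the cosets of `y` and `y'` costs at most `η y'` each way, so `(φ y', y)`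
    -- exceeds the minimum over `y` by at most `2 * η y'`; almost minimal points are close to the
    -- minimiser.
    have hclose (y' : X) : ‖p y - E.symm (φ y', y)‖ ≤
        C * √(4 * ((N (φ y, y) + 2 * η y') ^ 2 - N (φ y, y) ^ 2)) := by
      have hη_nonneg : 0 ≤ η y' := orbitNorm.nonneg _
      have hN_nonneg : 0 ≤ N (φ y, y) := orbitNorm.nonneg _
      have h1 : N (φ y', y) ≤ N (φ y', y') + η y' := by
        have := hNadd (φ y', y') (0, y - y')
        simpa [η] using this
      have h2 : N (φ y, y') ≤ N (φ y, y) + η y' := by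
        have := hNadd (φ y, y) (0, y' - y)
        rw [hη'] at this
        simpa using this
      have h3 := hmin (φ y) y'
      have hpy : orbitNorm π (p y) = N (φ y, y) := by rw [hp]
      refine orbitNorm.dist_le_of_almost_minimal hC1 hC (hKc y) (fun w hw => ?_) (hpK y)
        (hmem (φ y') y) ?_ ?_
      · rw [← hpy]
        exact pow_le_pow_left₀ (orbitNorm.nonneg _) (hpmin y w hw) 2
      · rw [hpy]
        exact pow_le_pow_left₀ hN_nonneg (by linarith) 2
      · exact pow_le_pow_left₀ (orbitNorm.nonneg _) (by change N (φ y', y) ≤ _; linarith) 2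
    have hlim : Tendsto (fun y' => E.symm (φ y', y)) (𝓝 y) (𝓝 (p y)) := by
      refine tendsto_iff_norm_sub_tendsto_zero.2 ?_
      refine squeeze_zero (fun _ => norm_nonneg _) (fun y' => ?_)
        (g := fun y' => C * √(4 * ((N (φ y, y) + 2 * η y') ^ 2 - N (φ y, y) ^ 2))) ?_
      · rw [norm_sub_rev]
        exact hclose y'
      · have : Continuous fun y' => C * √(4 * ((N (φ y, y) + 2 * η y') ^ 2 - N (φ y, y) ^ 2)) := by
          fun_prop
        have h := this.tendsto y
        rw [hη0] at h
        simpa using h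
    have := ((continuous_fst.comp E.continuous).tendsto (p y)).comp hlim
    refine this.congr fun y' => ?_
    simp only [Function.comp_apply, E.apply_symm_apply]
  · have h1 : N (c • φ x, c • x) = ‖c‖ * N (φ x, x) := hNsmul c (φ x, x)
    rw [h1]
    rcases eq_or_ne c 0 with rfl | hc
    · rw [norm_zero, zero_mul]
      exact orbitNorm.nonneg _
    · have h2 : N (φ (c • x), c • x) = ‖c‖ * N (c⁻¹ • φ (c • x), x) := by
        rw [← hNsmul]
        simp [smul_smul, mul_inv_cancel₀ hc]
      rw [h2]
      exact mul_le_mul_of_nonneg_left (hmin _ _) (norm_nonneg _)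
  · have h1 := snd_apply_eq (hinv A hA) (φ y) y
    set y' := (A (0, y)).2
    have h2 : A (φ y, y) = ((A (φ y, y)).1, y') := Prod.ext rfl h1
    rw [h2]
    -- The image of the minimiser is minimal in its coset: `A⁻¹` carries any competitor back to the
    -- coset of `y` without changing its norm.
    refine Prod.ext (huniq _ _ ?_) rfl
    rw [← h2, hNA A hA]
    have h3 : A⁻¹ (φ y', y') = ((A⁻¹ (φ y', y')).1, y) := by
      refine Prod.ext rfl ?_
      have h4 := snd_apply_eq (hinv _ (G.inv_mem hA))
      rw [h4, ← h4 (A (φ y, y)).1, ← h2]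
      change (A.symm (A (φ y, y))).2 = y
      rw [A.symm_apply_apply]
    rw [← hNA _ (G.inv_mem hA) (φ y', y'), h3]
    exact hmin _ _

/-- The block of `A ∈ G` on the invariant first summand. -/
noncomputable def upperBlock (G : Subgroup (GLGroup (X × X)))
    (hinv : ∀ A ∈ G, ∀ x : X, (A (x, 0)).2 = 0) : G →* (X →L[ℂ] X) where
  toFun A := ContinuousLinearMap.fst ℂ X X ∘L (A.1 : X × X →L[ℂ] X × X) ∘L
    ContinuousLinearMap.inl ℂ X X
  map_one' := rfl
  map_mul' A B := by
    ext x
    change (A.1 (B.1 (x, 0))).1 = (A.1 ((B.1 (x, 0)).1, 0)).1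
    exact congrArg (fun z => (A.1 z).1) (Prod.ext rfl (hinv B.1 B.2 x))

/-- The block of `A ∈ G` on the quotient by the first summand. -/
noncomputable def lowerBlock (G : Subgroup (GLGroup (X × X)))
    (hinv : ∀ A ∈ G, ∀ x : X, (A (x, 0)).2 = 0) : G →* (X →L[ℂ] X) where
  toFun A := ContinuousLinearMap.snd ℂ X X ∘L (A.1 : X × X →L[ℂ] X × X) ∘L
    ContinuousLinearMap.inr ℂ X X
  map_one' := rfl
  map_mul' A B := by
    ext y
    change (A.1 (B.1 (0, y))).2 = (A.1 (0, (B.1 (0, y)).2)).2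
    exact snd_apply_eq (hinv A.1 A.2) _ _

/-- A homomorphism into the monoid of operators takes values in `GL`. -/
noncomputable def toGL {Γ : Type*} [Group Γ] (F : Γ →* (X →L[ℂ] X)) : Γ →* GLGroup X :=
  (ContinuousLinearEquiv.unitsEquiv ℂ X).toMonoidHom.comp F.toHomUnits

/-- Multiplication and inversion are not continuous for the strong operator topology in general; the
uniform bound on `F` supplies the missing equicontinuity. -/
theorem isTopologicalGroup_induced_sot {Γ : Type*} [Group Γ] (F : Γ →* GLGroup X) {C : ℝ}
    (hC : ∀ g x, ‖F g x‖ ≤ C * ‖x‖) :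
    @IsTopologicalGroup Γ (TopologicalSpace.induced F (sot X)) _ := by
  let : TopologicalSpace (GLGroup X) := sot X
  let : TopologicalSpace Γ := TopologicalSpace.induced F (sot X)
  have hto {Y : Type _} [TopologicalSpace Y] (h : Y → Γ)
      (hh : ∀ x, Continuous fun y => F (h y) x) : Continuous h :=
    continuous_induced_rng.2 (continuous_induced_rng.2 (continuous_pi hh))
  have hev (x : X) : Continuous fun g => F g x :=
    (continuous_apply x).comp (continuous_induced_dom.comp continuous_induced_dom)
  have hmul : Continuous fun q : Γ × Γ => q.1 * q.2 := by
    refine hto _ fun x => continuous_iff_continuousAt.2 fun q => ?_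
    refine tendsto_iff_norm_sub_tendsto_zero.2 ?_
    refine squeeze_zero (fun _ => norm_nonneg _)
      (g := fun r => C * ‖F r.2 x - F q.2 x‖ + ‖F r.1 (F q.2 x) - F q.1 (F q.2 x)‖)
      (fun r => ?_) ?_
    · have h1 : F (r.1 * r.2) x - F (q.1 * q.2) x = F r.1 (F r.2 x - F q.2 x) +
          (F r.1 (F q.2 x) - F q.1 (F q.2 x)) := by
        rw [map_mul, map_mul, map_sub]
        change F r.1 (F r.2 x) - F q.1 (F q.2 x) = _
        abel
      rw [h1]
      exact (norm_add_le _ _).trans (add_le_add (hC _ _) le_rfl)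
    · have h1 : Continuous fun r : Γ × Γ =>
          C * ‖F r.2 x - F q.2 x‖ + ‖F r.1 (F q.2 x) - F q.1 (F q.2 x)‖ := by
        have := (hev x).comp (continuous_snd (X := Γ) (Y := Γ))
        have := (hev (F q.2 x)).comp (continuous_fst (X := Γ) (Y := Γ))
        simp only [Function.comp_def] at *
        fun_prop
      simpa using h1.tendsto q
  have hinv : Continuous fun g : Γ => g⁻¹ := by
    refine hto _ fun x => continuous_iff_continuousAt.2 fun q => ?_
    refine tendsto_iff_norm_sub_tendsto_zero.2 ?_
    refine squeeze_zero (fun _ => norm_nonneg _)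
      (g := fun r => C * ‖F q (F q⁻¹ x) - F r (F q⁻¹ x)‖) (fun r => ?_) ?_
    · have h1 : F r⁻¹ x - F q⁻¹ x = F r⁻¹ (F q (F q⁻¹ x) - F r (F q⁻¹ x)) := by
        rw [map_sub]
        simp only [map_inv]
        change (F r).symm x - (F q).symm x =
          (F r).symm (F q ((F q).symm x)) - (F r).symm (F r ((F q).symm x))
        rw [ContinuousLinearEquiv.apply_symm_apply, ContinuousLinearEquiv.symm_apply_apply]
      rw [h1]
      exact hC _ _
    · have h1 : Continuous fun r : Γ => C * ‖F q (F q⁻¹ x) - F r (F q⁻¹ x)‖ := by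
        have := hev (F q⁻¹ x)
        fun_prop
      simpa using h1.tendsto q
  exact { continuous_mul := hmul, continuous_inv := hinv }

/-- If idempotents commuting with `G` are trivial, then a `sot`-continuous homomorphism from `G`
which makes some matrix coefficient continuous is an isomorphism onto its image. -/
theorem isSotIsoOntoImage_of_idempotent [CompleteSpace X] {G : Subgroup (GLGroup (X × X))}
    (hG : IsBoundedSubgroup G)
    (htriv : ∀ P : (X × X) →L[ℂ] (X × X), (∀ A ∈ G, ∀ z, P (A z) = A (P z)) →
      (∀ z, P (P z) = P z) → (∀ z, P z = 0) ∨ ∀ z, P z = z)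
    (F : G →* GLGroup X) {C : ℝ} (hF : ∀ A x, ‖F A x‖ ≤ C * ‖x‖)
    (hFc : ∀ x, ∃ (z : X × X) (q : X × X → X), Continuous q ∧ ∀ A, F A x = q (A.1 z))
    (hcoeff : ∃ (z : X × X) (f : X × X →L[ℂ] ℂ), f z ≠ 0 ∧ ∀ l : Filter G,
      (∀ x, Tendsto (fun A => F A x) l (𝓝 x)) → Tendsto (fun A => f (A.1 z)) l (𝓝 (f z))) :
    IsSotIsoOntoImage G F := by
  obtain ⟨D, hD1, hD⟩ := exists_norm_hilbertRep_le hG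
  let E := WithLp.prodContinuousLinearEquiv 2 ℂ X X
  have hcont : ∀ z : X × X, @Continuous G (X × X) (TopologicalSpace.induced F (sot X)) _
      fun A => A.1 z := by
    let : TopologicalSpace G := TopologicalSpace.induced F (sot X)
    have : IsTopologicalGroup G := isTopologicalGroup_induced_sot F hF
    let : TopologicalSpace (GLGroup X) := sot X
    have hev (x : X) : Continuous fun A : G => F A x :=
      (continuous_apply x).comp (continuous_induced_dom.comp continuous_induced_dom)
    obtain ⟨P, hPc, hPf, hPid, hPcomm⟩ := exists_continuousVector_projection hD1 hD
    let Q : (X × X) →L[ℂ] (X × X) := (E : WithLp 2 (X × X) →L[ℂ] X × X) ∘L P ∘L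
      (E.symm : X × X →L[ℂ] WithLp 2 (X × X))
    have hQ (z : X × X) : Q z = E (P (E.symm z)) := rfl
    have hrep (A : G) (z : X × X) : hilbertRep G A (E.symm z) = E.symm (A.1 z) := by
      rw [hilbertRep_apply, ContinuousLinearEquiv.apply_symm_apply]
    rcases htriv Q (fun A hA z => by
        rw [hQ, hQ, ← hrep ⟨A, hA⟩ z, hPcomm, hilbertRep_apply,
          ContinuousLinearEquiv.apply_symm_apply])
      (fun z => by rw [hQ, hQ, E.symm_apply_apply, hPid _ (hPc _)]) with h | h
    -- The projection preserves the value of a functional along which the orbit is continuous, and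
    -- `hcoeff` provides one with `f z ≠ 0`.
    · exfalso
      obtain ⟨z, f, hfz, hf⟩ := hcoeff
      have h1 := hPf (E.symm z) (f ∘L (E : WithLp 2 (X × X) →L[ℂ] X × X)) (by
        have h2 := hf (𝓝 1) fun x => by
          have := (hev x).tendsto 1
          rwa [map_one] at this
        simpa [hrep] using h2)
      have h2 : f (Q z) = f z := by simpa [hQ] using h1
      rw [h, map_zero] at h2
      exact hfz h2.symm
    · intro z
      have h1 (w : WithLp 2 (X × X)) : IsContinuousVector (hilbertRep G) w := by
        have h2 : P w = w := by
          have := h (E w)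
          rw [hQ, E.symm_apply_apply] at this
          exact E.injective this
        exact h2 ▸ hPc w
      have h3 := E.continuous.comp (continuous_orbit h1 (E.symm z))
      refine h3.congr fun A => ?_
      rw [Function.comp_apply, hrep, E.apply_symm_apply]
  have hind : (@instTopologicalSpaceSubtype (GLGroup (X × X)) (fun A => A ∈ G) (sot (X × X))) =
      TopologicalSpace.induced F (sot X) := by
    refine le_antisymm ?_ ?_
    · rw [← continuous_iff_le_induced]
      let : TopologicalSpace (GLGroup (X × X)) := sot (X × X)
      refine continuous_induced_rng.2 (continuous_pi fun x => ?_)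
      obtain ⟨z, q, hq, hz⟩ := hFc x
      have h1 : Continuous fun A : GLGroup (X × X) => A z :=
        (continuous_apply z).comp continuous_induced_dom
      exact (hq.comp (h1.comp continuous_subtype_val)).congr fun A => (hz A).symm
    · refine le_trans ?_ (induced_compose (tγ := Pi.topologicalSpace)
        (f := (Subtype.val : G → GLGroup (X × X)))
        (g := fun (A : GLGroup (X × X)) => (A : X × X → X × X))).ge
      rw [← continuous_iff_le_induced]
      let : TopologicalSpace G := TopologicalSpace.induced F (sot X)
      exact continuous_pi hcont
  let : TopologicalSpace (GLGroup X) := sot X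
  let : TopologicalSpace G := TopologicalSpace.induced F (sot X)
  unfold IsSotIsoOntoImage
  rw [hind]
  -- The pulled-back topology is not known in advance to be Hausdorff. Elements with the same image
  -- are inseparable in it, and the continuous orbit maps into `X × X` then identify them.
  refine ⟨⟨rfl⟩, fun A B hAB => Subtype.ext (ContinuousLinearEquiv.ext (funext fun z => ?_))⟩
  have h1 : @Inseparable G (TopologicalSpace.induced F (sot X)) A B :=
    (Topology.IsInducing.inseparable_iff ⟨rfl⟩).1 (Inseparable.of_eq hAB)
  exact (h1.map (hcont z)).eq

theorem isSotIsoOntoImage_upperBlock [CompleteSpace X] {G : Subgroup (GLGroup (X × X))}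
    (hinv : ∀ A ∈ G, ∀ x : X, (A (x, 0)).2 = 0) (hG : IsBoundedSubgroup G)
    (htriv : ∀ P : (X × X) →L[ℂ] (X × X), (∀ A ∈ G, ∀ z, P (A z) = A (P z)) →
      (∀ z, P (P z) = P z) → (∀ z, P z = 0) ∨ ∀ z, P z = z)
    {f : X →L[ℂ] ℂ} {x₀ : X} (hf : f x₀ ≠ 0) :
    IsSotIsoOntoImage G (toGL (upperBlock G hinv)) := by
  obtain ⟨C, hC⟩ := hG
  refine isSotIsoOntoImage_of_idempotent ⟨C, hC⟩ htriv _ (C := C) (fun A x => ?_)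
    (fun x => ⟨(x, 0), Prod.fst, continuous_fst, fun A => rfl⟩)
    ⟨(x₀, 0), f ∘L ContinuousLinearMap.fst ℂ X X, hf, fun l hl => ?_⟩
  · have h1 : ‖A.1 (x, 0)‖ ≤ C * ‖((x, 0) : X × X)‖ :=
      (A.1 : X × X →L[ℂ] X × X).le_of_opNorm_le (hC A.1 A.2) _
    have h2 : ‖((x, 0) : X × X)‖ = ‖x‖ := by simp [Prod.norm_def]
    rw [h2] at h1
    exact (norm_fst_le (A.1 (x, 0))).trans h1
  · exact (f.continuous.tendsto x₀).comp (hl x₀)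

theorem isSotIsoOntoImage_lowerBlock [CompleteSpace X] {G : Subgroup (GLGroup (X × X))}
    (hinv : ∀ A ∈ G, ∀ x : X, (A (x, 0)).2 = 0) (hG : IsBoundedSubgroup G)
    (htriv : ∀ P : (X × X) →L[ℂ] (X × X), (∀ A ∈ G, ∀ z, P (A z) = A (P z)) →
      (∀ z, P (P z) = P z) → (∀ z, P z = 0) ∨ ∀ z, P z = z)
    {f : X →L[ℂ] ℂ} {x₀ : X} (hf : f x₀ ≠ 0) :
    IsSotIsoOntoImage G (toGL (lowerBlock G hinv)) := by
  obtain ⟨C, hC⟩ := hG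
  refine isSotIsoOntoImage_of_idempotent ⟨C, hC⟩ htriv _ (C := C) (fun A x => ?_)
    (fun x => ⟨(0, x), Prod.snd, continuous_snd, fun A => rfl⟩)
    ⟨(0, x₀), f ∘L ContinuousLinearMap.snd ℂ X X, hf, fun l hl => ?_⟩
  · have h1 : ‖A.1 (0, x)‖ ≤ C * ‖((0, x) : X × X)‖ :=
      (A.1 : X × X →L[ℂ] X × X).le_of_opNorm_le (hC A.1 A.2) _
    have h2 : ‖((0, x) : X × X)‖ = ‖x‖ := by simp [Prod.norm_def]
    rw [h2] at h1
    exact (norm_snd_le (A.1 (0, x))).trans h1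
  · exact (f.continuous.tendsto x₀).comp (hl x₀)

end BoundedSubgroup

/-! ### Assembly of the theorem. -/

theorem mainTheorem1 {V : Type*} [Countable V] (T : SimpleGraph V) (hT : T.IsTree)
    (hdeg : ∀ v : V, (T.neighborSet v).Infinite) (e : V)
    (G : Subgroup (GLGroup (Ell V 2 × Ell V 2)))
    (hbdd : IsBoundedSubgroup G)
    (hinv : ∀ A ∈ G, ∀ x : Ell V 2, (A (x, 0)).2 = 0)
    (hG : (TreeDerivation.lamD hT e).range ≤ G) :
    ∃ ψ : Ell V 2 → Ell V 2,
      Continuous ψ ∧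
      (∀ (c : ℂ) (x : Ell V 2), ψ (c • x) = c • ψ x) ∧
      (∀ (g : T ≃g T) (x : Ell V 2),
        TreeDerivation.Lstar hT e (ellIncl V le_top (lam 2 g x)) +
            ellIncl V le_top (ψ (lam 2 g x)) =
          lam ∞ g (TreeDerivation.Lstar hT e (ellIncl V le_top x) + ellIncl V le_top (ψ x))) ∧
      (∀ (g : T ≃g T) (x : Ell V 1),
        ellIncl V one_le_two (TreeDerivation.L hT e (lam 1 g x)) -
            ψ (ellIncl V one_le_two (lam 1 g x)) =
          lam 2 g (ellIncl V one_le_two (TreeDerivation.L hT e x) -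
            ψ (ellIncl V one_le_two x))) ∧
      ∃ u v : G →* GLGroup (Ell V 2),
        (∀ (A : G) (x y : Ell V 2),
          (A : GLGroup (Ell V 2 × Ell V 2)) (x, y) =
            (u A x + (u A (ψ y) - ψ (v A y)), v A y)) ∧
        IsSotIsoOntoImage G u ∧ IsSotIsoOntoImage G v := by
  classical
  obtain ⟨φ, hφc, hφs, hφ⟩ := exists_invariant_graph hbdd hinv
  have hmem (g : T ≃g T) : TreeDerivation.lamD hT e g ∈ G := hG ⟨g, rfl⟩
  have hd (g : T ≃g T) (x : Ell V 2) :
      TreeDerivation.d hT e g x = φ (lam 2 g x) - lam 2 g (φ x) := by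
    have h1 := hφ _ (hmem g) x
    rw [TreeDerivation.lamD_apply, TreeDerivation.lamD_apply] at h1
    exact eq_sub_of_add_eq' (congrArg Prod.fst h1)
  obtain ⟨C, hC⟩ := hbdd
  have htriv (P : (Ell V 2 × Ell V 2) →L[ℂ] (Ell V 2 × Ell V 2))
      (hP : ∀ A ∈ G, ∀ z, P (A z) = A (P z)) (hPP : ∀ z, P (P z) = P z) :=
    TreeDerivation.eq_zero_or_one_of_commute_lamD hT hdeg e P (fun g => hP _ (hmem g)) hPP
  let x₀ : Ell V 2 := lp.single 2 e (1 : ℂ)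
  let ev : Ell V 2 →L[ℂ] ℂ := lp.evalCLM ℂ (fun _ : V => ℂ) 2 e
  have hev : ev x₀ ≠ 0 := by
    have h1 : ev x₀ = x₀ e := rfl
    rw [h1, lp.single_apply_self]
    exact one_ne_zero
  -- The sign comes from `hd`: it is `L* - φ` that commutes with the shift.
  refine ⟨fun x => -φ x, hφc.neg, fun c x => by simp only [hφs, smul_neg], fun g x => ?_, fun g x => ?_,
    toGL (upperBlock G hinv), toGL (lowerBlock G hinv), fun A x y => ?_, ?_, ?_⟩
  · have h1 := TreeDerivation.ellIncl_d hT e g x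
    have h2 (z : Ell V 2) :
        lam ∞ g (ellIncl V le_top z) = ellIncl V (le_top : (2 : ℝ≥0∞) ≤ ∞) (lam 2 g z) := rfl
    rw [hd, map_sub, h2 x] at h1
    rw [map_add, h2, map_neg, map_neg, map_neg, ← sub_eq_add_neg, ← sub_eq_add_neg,
      sub_eq_sub_iff_sub_eq_sub, ← h1]
  · have h1 := TreeDerivation.ellIncl_L_lam hT e g x
    have h2 : ellIncl V one_le_two (lam 1 g x) =
        lam 2 g (ellIncl V (one_le_two : (1 : ℝ≥0∞) ≤ 2) x) := rfl
    rw [hd, sub_eq_iff_eq_add] at h1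
    simp only [sub_neg_eq_add]
    rw [h1, h2, map_add]
    abel
  · have h1 := hφ A.1 A.2 y
    -- Split off the point of the invariant graph; the remainder lies in the invariant first
    -- summand, where `A` acts linearly by its upper block.
    have h2 : ((x, y) : Ell V 2 × Ell V 2) = (x - φ y, 0) + (φ y, y) := by simp
    rw [h2, map_add, h1]
    refine Prod.ext ?_ ?_
    · change (A.1 (x - φ y, 0)).1 + φ (A.1 (0, y)).2 =
        (A.1 (x, 0)).1 + ((A.1 (-φ y, 0)).1 - -φ (A.1 (0, y)).2)
      have h3 : ((x - φ y, 0) : Ell V 2 × Ell V 2) = (x, 0) + (-φ y, 0) := by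
        simp [sub_eq_add_neg]
      rw [h3, map_add, Prod.fst_add]
      abel
    · change (A.1 (x - φ y, 0)).2 + (A.1 (0, y)).2 = (A.1 (0, y)).2
      rw [hinv A.1 A.2, zero_add]
  · exact isSotIsoOntoImage_upperBlock hinv ⟨C, hC⟩ htriv hev
  · exact isSotIsoOntoImage_lowerBlock hinv ⟨C, hC⟩ htriv hev
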